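/- Let $d\in\{2,3\}$, let $\Omega\subset\mathbb R^d$ be a bounded domain (nonempty, open, connected) with boundary $\Gamma=\partial\Omega$, and let $k\ge 1$ be an integer. Let $\mathcal T_h$ be a finite partition of $\overline\Omega$ into closed polygons ($d=2$) or polyhedra ($d=3$), not necessarily convex, with nonempty connected interiors that are pairwise disjoint. Let $\mathcal E_h$ be its finite set of edges ($d=2$) or flat polygonal faces ($d=3$): the boundary of every $T\in\mathcal T_h$ is the union of the $e\in\mathcal E_h$ contained in it, every $e\in\mathcal E_h$ is contained in $\partial T$ for some $T\in\mathcal T_h$, and different members of $\mathcal E_h$ have disjoint relative interiors. Let $h_T$ be the diameter of $T$. Let $\mathsf{RM}$ be the space of rigid motions $x\mapsto a+\eta x$ with $a\in\mathbb R^d$ and $\eta$ a skew-symmetric $d\times d$ matrix, and for $e\in\mathcal E_h$ let $V_{k-1}(e)=[P_{k-1}(e)]^d+\mathsf{RM}|_e\subset[L^2(e)]^d$. Let $Q_b$ be the $L^2(e)$-orthogonal projection onto $V_{k-1}(e)$ on each $e\in\mathcal E_h$. Let $V_h$ be the linear space of the pairs $v=\{v_0,v_b\}$, where $v_0$ has a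 component $v_0|_T\in[P_k(T)]^d$ for every $T\in\mathcal T_h$ (with no continuity between elements), and $v_b$ has a single component $v_b|_e\in V_{k-1}(e)$ for every $e\in\mathcal E_h$. Let $V_h^0$ be the subspace of those $v\in V_h$ with $v_b=0$ on every $e\in\mathcal E_h$ contained in $\Gamma$. With $\varepsilon(v_0)=\frac12(\nabla v_0+\nabla v_0^T)$, put $$|||v|||=\Big(\sum_{T\in\mathcal T_h}\Big(\|\varepsilon(v_0)\|_{L^2(T)}^2+h_T^{-1}\sum_{e\in\mathcal E_h,\ e\subset\partial T}\|Q_b (v_0|_T)-v_b\|_{L^2(e)}^2\Big)\Big)^{1/2},\qquad v\in V_h .$$ Then $|||\cdot|||$ is a seminorm on $V_h$ (nonnegative, absolutely homogeneous, and satisfying the triangle inequality), and it is a norm on $V_h^0$: for $v\in V_h^0$ one has $|||v|||=0$ if and only if $v=0$. -/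

import Mathlib

noncomputable section

namespace WG

open MeasureTheory

/-- The Euclidean space `ℝ^d`. -/
abbrev E (d : ℕ) : Type := EuclideanSpace ℝ (Fin d)

/-- `S ⊆ ℝ^d` is an `n`-dimensional polytope, closed and not necessarily convex: a finite union of
`n`-dimensional convex polytopes which spans an `n`-dimensional affine subspace and whose interior
relative to that subspace is nonempty and connected.  For `n = 1, 2, 3` these are the segments, the
flat polygons and the polyhedra. -/
structure IsPolytope {d : ℕ} (n : ℕ) (S : Set (E d)) : Prop where
  finrank_vectorSpan : Module.finrank ℝ (vectorSpan ℝ S) = n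
  exists_pieces : ∃ F : Finset (Finset (E d)),
    (∀ P ∈ F, Module.finrank ℝ (vectorSpan ℝ (P : Set (E d))) = n) ∧
      S = ⋃ P ∈ F, convexHull ℝ (P : Set (E d))
  isConnected_interior : IsConnected (intrinsicInterior ℝ S)

/-- A finite partition of `Ω` into polygons (`d = 2`) or polyhedra (`d = 3`), with its set of edges
(`d = 2`) or flat faces (`d = 3`).  The word face is used for both. -/
structure Partition {d : ℕ} (Ω : Set (E d)) where
  /-- the elements `T`, as closed sets -/
  cells : Finset (Set (E d))
  /-- the edges or faces `e`, as closed sets -/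
  faces : Finset (Set (E d))
  isPolytope_cell : ∀ T ∈ cells, IsPolytope d T
  isPolytope_face : ∀ e ∈ faces, IsPolytope (d - 1) e
  iUnion_cells : ⋃ T ∈ cells, T = closure Ω
  disjoint_cells : ∀ T ∈ cells, ∀ T' ∈ cells, T ≠ T' → Disjoint (interior T) (interior T')
  /-- the boundary of an element is made up of the faces that it contains -/
  frontier_cell : ∀ T ∈ cells, frontier T = ⋃ e ∈ faces, ⋃ _ : e ⊆ frontier T, e
  /-- every face is a face of an element -/
  exists_cell : ∀ e ∈ faces, ∃ T ∈ cells, e ⊆ frontier T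
  /-- different faces do not overlap -/
  disjoint_faces : ∀ e ∈ faces, ∀ e' ∈ faces, e ≠ e' →
    Disjoint (intrinsicInterior ℝ e) (intrinsicInterior ℝ e')

/-- The vector fields on `ℝ^d` whose components are polynomials of total degree at most `r`.
For a set `T` with nonempty interior this is `[P_r(T)]^d`: a polynomial on `T` is identified with
the polynomial function on `ℝ^d` of which it is the restriction. -/
def polyField (d r : ℕ) : Submodule ℝ C(E d, E d) where
  carrier := {v | ∃ p : Fin d → MvPolynomial (Fin d) ℝ, (∀ i, (p i).totalDegree ≤ r) ∧
    ∀ x i, v x i = MvPolynomial.eval (fun j => x j) (p i)}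
  add_mem' := by
    rintro v w ⟨p, hp, hv⟩ ⟨q, hq, hw⟩
    exact ⟨p + q, fun i => (MvPolynomial.totalDegree_add _ _).trans (max_le (hp i) (hq i)),
      fun x i => by simp [hv, hw]⟩
  zero_mem' := ⟨0, fun i => by simp, fun x i => by simp⟩
  smul_mem' := by
    rintro c v ⟨p, hp, hv⟩
    exact ⟨c • p, fun i => (MvPolynomial.totalDegree_smul_le _ _).trans (hp i),
      fun x i => by simp [hv, MvPolynomial.smul_eval]⟩

/-- The rigid motions `x ↦ a + η x` with `η` a skew-symmetric matrix. -/
def rigidMotion (d : ℕ) : Submodule ℝ C(E d, E d) where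
  carrier := {v | ∃ (a : E d) (η : Matrix (Fin d) (Fin d) ℝ), η.transpose = -η ∧
    ∀ x, v x = a + Matrix.toEuclideanLin η x}
  add_mem' := by
    rintro v w ⟨a, η, hη, hv⟩ ⟨b, ξ, hξ, hw⟩
    refine ⟨a + b, η + ξ, ?_, fun x => ?_⟩
    · rw [Matrix.transpose_add, hη, hξ, neg_add]
    · rw [ContinuousMap.add_apply, hv, hw, map_add, LinearMap.add_apply]
      abel
  zero_mem' := ⟨0, 0, by simp, fun x => by simp⟩
  smul_mem' := by
    rintro c v ⟨a, η, hη, hv⟩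
    refine ⟨c • a, c • η, ?_, fun x => ?_⟩
    · rw [Matrix.transpose_smul, hη, smul_neg]
    · rw [ContinuousMap.smul_apply, hv, map_smul, LinearMap.smul_apply, smul_add]

/-- The length (`d = 2`) or area (`d = 3`) measure on `e`. -/
abbrev faceMeasure {d : ℕ} (e : Set (E d)) : Measure (E d) :=
  (Measure.euclideanHausdorffMeasure (d - 1)).restrict e

/-- `[L²(e)]^d`. -/
abbrev FaceL2 {d : ℕ} (e : Set (E d)) : Type := Lp (E d) 2 (faceMeasure e)

theorem IsPolytope.isCompact {d n : ℕ} {S : Set (E d)} (h : IsPolytope n S) : IsCompact S := by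
  obtain ⟨F, -, rfl⟩ := h.exists_pieces
  exact F.isCompact_biUnion fun P _ => P.finite_toSet.isCompact_convexHull (𝕜 := ℝ)

theorem IsPolytope.measure_lt_top {d n : ℕ} {S : Set (E d)} (h : IsPolytope n S) :
    Measure.euclideanHausdorffMeasure n S < ⊤ := by
  classical
  have hne : S.Nonempty := h.isConnected_interior.nonempty.mono (intrinsicInterior_subset (𝕜 := ℝ))
  obtain ⟨x, hx⟩ := hne
  have hxA : x ∈ affineSpan ℝ S := subset_affineSpan ℝ S hx
  have : Nonempty (affineSpan ℝ S) := ⟨⟨x, hxA⟩⟩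
  set s : Set (affineSpan ℝ S) := (↑) ⁻¹' S with hs
  have hS : ((↑) : affineSpan ℝ S → E d) '' s = S := by
    refine Set.image_preimage_eq_of_subset ?_
    rw [Subtype.range_coe_subtype]
    exact subset_affineSpan ℝ S
  rw [← hS, AffineSubspace.euclideanHausdorffMeasure_coe_image]
  have hn : n = Module.finrank ℝ (affineSpan ℝ S).direction := by
    rw [direction_affineSpan, h.finrank_vectorSpan]
  rw [hn, EuclideanGeometry.euclideanHausdorffMeasure_eq (⟨x, hxA⟩ : affineSpan ℝ S)]
  have hclosed : IsClosed ((affineSpan ℝ S : AffineSubspace ℝ (E d)) : Set (E d)) :=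
    AffineSubspace.closed_of_finiteDimensional _
  have hsc : IsCompact s :=
    hclosed.isClosedEmbedding_subtypeVal.isCompact_preimage h.isCompact
  rw [Measure.map_apply (IsometryEquiv.vaddConst _).continuous.measurable hsc.measurableSet]
  exact ((IsometryEquiv.vaddConst (⟨x, hxA⟩ : affineSpan ℝ S)).toHomeomorph.isCompact_preimage.2
    hsc).measure_lt_top

theorem IsPolytope.memLp {d : ℕ} {e : Set (E d)} (h : IsPolytope (d - 1) e) (v : C(E d, E d)) :
    MemLp v 2 (faceMeasure e) := by
  have : IsFiniteMeasure (faceMeasure e) := ⟨by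
    rw [Measure.restrict_apply_univ]; exact h.measure_lt_top⟩
  obtain ⟨C, hC⟩ := h.isCompact.exists_bound_of_continuousOn v.continuous.continuousOn
  exact MemLp.of_bound v.continuous.aestronglyMeasurable C
    ((ae_restrict_iff' h.isCompact.measurableSet).2 (Filter.Eventually.of_forall hC))

/-- The trace `v ↦ v|_e` on a face, with values in `[L²(e)]^d`. -/
def trace {d : ℕ} {e : Set (E d)} (h : IsPolytope (d - 1) e) : C(E d, E d) →ₗ[ℝ] FaceL2 e where
  toFun v := (h.memLp v).toLp v
  map_add' v w := MemLp.toLp_add (h.memLp v) (h.memLp w)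
  map_smul' c v := MemLp.toLp_const_smul c (h.memLp v)

/-- `V_{k-1}(e) = [P_{k-1}(e)]^d + P_RM(e)`, as a subspace of `[L²(e)]^d`. -/
def faceSpace {d : ℕ} (k : ℕ) {e : Set (E d)} (h : IsPolytope (d - 1) e) :
    Submodule ℝ (FaceL2 e) :=
  (polyField d (k - 1)).map (trace h) ⊔ (rigidMotion d).map (trace h)

theorem rigidMotion_le (d : ℕ) : rigidMotion d ≤ polyField d 1 := by
  rintro v ⟨a, η, -, hv⟩
  refine ⟨fun i => MvPolynomial.C (a i) + ∑ j, MvPolynomial.C (η i j) * MvPolynomial.X j,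
    fun i => ?_, fun x i => ?_⟩
  · refine (MvPolynomial.totalDegree_add _ _).trans (max_le (by simp) ?_)
    refine MvPolynomial.totalDegree_finsetSum_le fun j _ => ?_
    exact (MvPolynomial.totalDegree_mul _ _).trans (by simp)
  · simp [hv, Matrix.toLpLin_apply, Matrix.mulVec, dotProduct]

instance finiteDimensional_polyField (d r : ℕ) : FiniteDimensional ℝ (polyField d r) := by
  let φ : polyField d r →ₗ[ℝ] (E d → Fin d → ℝ) :=
    { toFun := fun v x i => v.1 x i
      map_add' := fun v w => rfl
      map_smul' := fun c v => rfl }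
  let ψ : (Fin d → MvPolynomial.restrictTotalDegree (Fin d) ℝ r) →ₗ[ℝ] (E d → Fin d → ℝ) :=
    { toFun := fun p x i => MvPolynomial.eval (fun j => x j) (p i).1
      map_add' := fun p q => by ext x i; simp
      map_smul' := fun c p => by ext x i; simp [MvPolynomial.smul_eval] }
  have hφ : Function.Injective φ := by
    intro v w h
    ext x i
    exact congrFun (congrFun h x) i
  have hle : LinearMap.range φ ≤ LinearMap.range ψ := by
    rintro _ ⟨⟨v, p, hp, hv⟩, rfl⟩
    refine ⟨fun i => ⟨p i, (MvPolynomial.mem_restrictTotalDegree _ _ _).2 (hp i)⟩, ?_⟩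
    ext x i
    exact (hv x i).symm
  have : FiniteDimensional ℝ (LinearMap.range φ) := Submodule.finiteDimensional_of_le hle
  exact LinearEquiv.finiteDimensional (LinearEquiv.ofInjective φ hφ).symm

instance finiteDimensional_faceSpace {d : ℕ} (k : ℕ) {e : Set (E d)}
    (h : IsPolytope (d - 1) e) : FiniteDimensional ℝ (faceSpace k h) := by
  have : FiniteDimensional ℝ (rigidMotion d) := Submodule.finiteDimensional_of_le (rigidMotion_le d)
  unfold faceSpace
  infer_instance

/-- The `L²` projection `Q_b` of `[L²(e)]^d` onto `V_{k-1}(e)`. -/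
def Qb {d : ℕ} (k : ℕ) {e : Set (E d)} (h : IsPolytope (d - 1) e) : FaceL2 e →L[ℝ] FaceL2 e :=
  (faceSpace k h).starProjection

/-- The strain tensor `ε(v) = (∇v + ∇vᵀ) / 2`. -/
def strain {d : ℕ} (v : C(E d, E d)) (x : E d) : Matrix (Fin d) (Fin d) ℝ := fun i j =>
  (fderiv ℝ v x (EuclideanSpace.single j 1) i + fderiv ℝ v x (EuclideanSpace.single i 1) j) / 2

namespace Partition

variable {d : ℕ} {Ω : Set (E d)} (𝒯 : Partition Ω)

/-- Pairs `v = {v_0, v_b}`: a vector field `v_0` for each element and an `L²` vector field `v_b` on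
each face.  The faces are not doubled, so that `v_b` is single-valued on the interfaces. -/
abbrev WeakFunction : Type :=
  (𝒯.cells → C(E d, E d)) × ((e : 𝒯.faces) → FaceL2 (e : Set (E d)))

/-- The weak finite element space `V_h`: `v_0 ∈ [P_k(T)]^d` on each element `T` and
`v_b ∈ V_{k-1}(e)` on each face `e`. -/
def Vh (k : ℕ) : Submodule ℝ 𝒯.WeakFunction where
  carrier := {v | (∀ T, v.1 T ∈ polyField d k) ∧
    ∀ e : 𝒯.faces, v.2 e ∈ faceSpace k (𝒯.isPolytope_face e e.2)}
  add_mem' := fun hv hw =>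
    ⟨fun T => add_mem (hv.1 T) (hw.1 T), fun e => add_mem (hv.2 e) (hw.2 e)⟩
  zero_mem' := ⟨fun _ => zero_mem _, fun _ => zero_mem _⟩
  smul_mem' := fun c _ hv =>
    ⟨fun T => Submodule.smul_mem _ c (hv.1 T), fun e => Submodule.smul_mem _ c (hv.2 e)⟩

/-- The subspace `V_h^0` of the `v ∈ V_h` with `v_b = 0` on `∂Ω`. -/
def Vh0 (k : ℕ) : Submodule ℝ 𝒯.WeakFunction where
  carrier := {v | v ∈ 𝒯.Vh k ∧ ∀ e : 𝒯.faces, (e : Set (E d)) ⊆ frontier Ω → v.2 e = 0}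
  add_mem' := fun hv hw => ⟨add_mem hv.1 hw.1, fun e he => by
    rw [Prod.snd_add, Pi.add_apply, hv.2 e he, hw.2 e he, add_zero]⟩
  zero_mem' := ⟨zero_mem _, fun _ _ => rfl⟩
  smul_mem' := fun c _ hv => ⟨Submodule.smul_mem _ c hv.1, fun e he => by
    rw [Prod.smul_snd, Pi.smul_apply, hv.2 e he, smul_zero]⟩

open scoped Classical in
/-- `(∑_T (‖ε(v_0)‖_T² + h_T⁻¹ ‖Q_b v_0 - v_b‖_{∂T}²))^{1/2}`. -/
def tripleNorm (k : ℕ) (v : 𝒯.WeakFunction) : ℝ :=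
  Real.sqrt (∑ T : 𝒯.cells,
    ((∫ x in (T : Set (E d)), ∑ i, ∑ j, strain (v.1 T) x i j ^ 2) +
      (Metric.diam (T : Set (E d)))⁻¹ *
        ∑ e : 𝒯.faces, if (e : Set (E d)) ⊆ frontier (T : Set (E d)) then
          ‖Qb k (𝒯.isPolytope_face e e.2) (trace (𝒯.isPolytope_face e e.2) (v.1 T)) - v.2 e‖ ^ 2
        else 0))

end Partition

end WG

end

/-! The triple norm is the Euclidean norm of a finite family of seminorms, each an `L²` norm of a
linear image of `v`; this gives the seminorm properties. Suppose it vanishes at `v`. The strain of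
`v_0` is then zero on each element, so `v_0` is a rigid motion there
(`mem_rigidMotion_of_strainLp_eq_zero`). Since `V_{k-1}(e)` contains the traces of rigid motions,
`Q_b` fixes them, and `v_b` is the trace of `v_0` from every element at `e`. A rigid motion that
vanishes on a face is zero (`eq_zero_of_mem_rigidMotion_of_eqOn`). Hence the vanishing of `v_0`
starts at an element with a face on `Γ`, where `v_b = 0`, and passes across shared faces.

What remains is geometry: some face lies in `Γ` (`exists_face_subset_frontier`), and shared faces
link all elements (`forall_cell_of_forall_shared_face`). Elements may touch in sets of low
dimension, so both arguments follow a segment in general position. The relative boundaries of the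
faces lie in finitely many affine subspaces of codimension at least two, which such a segment
misses; so each of its points is on at most one face. -/

noncomputable section

namespace WG

open MeasureTheory
open scoped ContDiff

/-! ### Avoiding finitely many affine subspaces -/

/-- Proper affine subspaces are null sets for Haar measure, and a nonempty open set is not. -/
theorem exists_mem_forall_notMem_affineSubspace {F ι : Type*} [NormedAddCommGroup F]
    [NormedSpace ℝ F] [FiniteDimensional ℝ F] {U : Set F} (hU : IsOpen U) (hne : U.Nonempty)
    (s : Finset ι) (A : ι → AffineSubspace ℝ F) (hA : ∀ i ∈ s, A i ≠ ⊤) :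
    ∃ x ∈ U, ∀ i ∈ s, x ∉ A i := by
  borelize F
  by_contra! h
  have hsub : U ⊆ ⋃ i ∈ s, (A i : Set F) := fun x hx => by
    obtain ⟨i, hi, hxi⟩ := h x hx
    exact Set.mem_biUnion hi hxi
  have h0 : (Measure.addHaar : Measure F) (⋃ i ∈ s, (A i : Set F)) = 0 :=
    (measure_biUnion_null_iff s.countable_toSet).2 fun i hi =>
      Measure.addHaar_affineSubspace _ _ (hA i hi)
  exact (hU.measure_pos _ hne).ne' (measure_mono_null hsub h0)

theorem exists_mem_inter_forall_notMem_affineSubspace {F ι : Type*} [NormedAddCommGroup F]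
    [NormedSpace ℝ F] [FiniteDimensional ℝ F] {U : Set F} (hU : IsOpen U)
    (B : AffineSubspace ℝ F) {x₀ : F} (hx₀ : x₀ ∈ U) (hB : x₀ ∈ B)
    (s : Finset ι) (A : ι → AffineSubspace ℝ F) (hA : ∀ i ∈ s, ¬ B ≤ A i) :
    ∃ x ∈ U, x ∈ B ∧ ∀ i ∈ s, x ∉ A i := by
  let φ : B.direction →ᵃ[ℝ] F :=
    B.direction.subtype.toAffineMap + AffineMap.const ℝ B.direction x₀
  have hφ : ∀ v, φ v = (v : F) + x₀ := fun v => rfl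
  have hφB : ∀ v, φ v ∈ B := fun v => B.vadd_mem_of_mem_direction v.2 hB
  have hc : Continuous φ := by
    show Continuous fun v : B.direction => (v : F) + x₀
    fun_prop
  obtain ⟨v, hv, hvA⟩ := exists_mem_forall_notMem_affineSubspace (hU.preimage hc)
    ⟨0, by simpa [hφ] using hx₀⟩ s (fun i => (A i).comap φ) fun i hi h => hA i hi fun y hy => by
      have : (⟨y - x₀, B.vsub_mem_direction hy hB⟩ : B.direction) ∈ (A i).comap φ := by
        rw [h]; trivial
      simpa [AffineSubspace.mem_comap, hφ] using this
  exact ⟨φ v, hv, hφB v, hvA⟩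

/-- `B` is isometric to its direction, where the Hausdorff measure is the volume. -/
theorem measure_open_inter_affineSubspace_pos {d : ℕ} (B : AffineSubspace ℝ (E d)) {n : ℕ}
    (hn : Module.finrank ℝ B.direction = n) {U : Set (E d)} (hU : IsOpen U) {x : E d}
    (hx : x ∈ U) (hxB : x ∈ B) : 0 < Measure.euclideanHausdorffMeasure n (U ∩ B) := by
  have : Nonempty B := ⟨⟨x, hxB⟩⟩
  have hS : ((↑) : B → E d) '' ((↑) ⁻¹' U) = U ∩ B := Subtype.image_preimage_coe _ _ |>.trans
    (Set.inter_comm _ _)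
  rw [← hS, AffineSubspace.euclideanHausdorffMeasure_coe_image, ← hn,
    EuclideanGeometry.euclideanHausdorffMeasure_eq (⟨x, hxB⟩ : B)]
  have hUo : IsOpen (((↑) : B → E d) ⁻¹' U) := hU.preimage continuous_subtype_val
  rw [Measure.map_apply (IsometryEquiv.vaddConst _).continuous.measurable hUo.measurableSet]
  refine (hUo.preimage (IsometryEquiv.vaddConst _).continuous).measure_pos _ ⟨0, ?_⟩
  simpa using hx

/-! ### Relative interiors of convex sets and polytopes -/

theorem mem_intrinsicInterior_iff_exists_isOpen {F : Type*} [NormedAddCommGroup F]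
    [NormedSpace ℝ F] {S : Set F} {x : F} :
    x ∈ intrinsicInterior ℝ S ↔
      x ∈ affineSpan ℝ S ∧ ∃ U, IsOpen U ∧ x ∈ U ∧ U ∩ affineSpan ℝ S ⊆ S := by
  rw [mem_intrinsicInterior]
  constructor
  · rintro ⟨y, hy, rfl⟩
    obtain ⟨t, ht, hto, hyt⟩ := mem_interior.1 hy
    obtain ⟨U, hU, rfl⟩ := isOpen_induced_iff.1 hto
    exact ⟨y.2, U, hU, hyt, fun z hz => ht (show (⟨z, hz.2⟩ : affineSpan ℝ S) ∈ _ from hz.1)⟩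
  · rintro ⟨hx, U, hU, hxU, h⟩
    exact ⟨⟨x, hx⟩, mem_interior.2 ⟨_, fun z hz => h ⟨hz, z.2⟩,
      hU.preimage continuous_subtype_val, hxU⟩, rfl⟩

/-- The homothety with centre `y` and ratio `t⁻¹` sends the point to `x`; a point that it sends into
`C` is itself a convex combination of `y` and its image. -/
theorem lineMap_mem_intrinsicInterior {F : Type*} [NormedAddCommGroup F]
    [NormedSpace ℝ F] {C : Set F} (hC : Convex ℝ C) {x y : F} (hy : y ∈ C)
    (hx : x ∈ intrinsicInterior ℝ C) {t : ℝ} (ht0 : 0 < t) (ht1 : t < 1) :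
    AffineMap.lineMap y x t ∈ intrinsicInterior ℝ C := by
  obtain ⟨hxC, U, hU, hxU, hUC⟩ := mem_intrinsicInterior_iff_exists_isOpen.1 hx
  have hyC := subset_affineSpan ℝ C hy
  refine mem_intrinsicInterior_iff_exists_isOpen.2 ⟨AffineMap.lineMap_mem t hyC hxC,
    (fun u => AffineMap.homothety y t⁻¹ u) ⁻¹' U,
    hU.preimage (AffineMap.homothety_continuous _ _), ?_, ?_⟩
  · simpa [AffineMap.homothety_apply, AffineMap.lineMap_apply, smul_smul, ht0.ne'] using hxU
  · rintro u ⟨huU, hu⟩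
    have hs : AffineMap.homothety y t⁻¹ u ∈ C := hUC ⟨huU, by
      rw [AffineMap.homothety_eq_lineMap]; exact AffineMap.lineMap_mem _ hyC hu⟩
    have := hC hy hs (sub_nonneg.2 ht1.le) ht0.le (sub_add_cancel _ _)
    convert this using 1
    simp only [AffineMap.homothety_apply, vsub_eq_sub, vadd_eq_add, smul_add, smul_smul,
      mul_inv_cancel₀ ht0.ne', one_smul, sub_smul]
    abel

theorem subset_closure_intrinsicInterior {F : Type*} [NormedAddCommGroup F]
    [NormedSpace ℝ F] [FiniteDimensional ℝ F] {C : Set F} (hC : Convex ℝ C) :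
    C ⊆ closure (intrinsicInterior ℝ C) := by
  intro y hy
  obtain ⟨x, hx⟩ := Set.Nonempty.intrinsicInterior hC ⟨y, hy⟩
  have hc : Continuous fun t : ℝ => AffineMap.lineMap y x t := AffineMap.lineMap_continuous
  have h0 : Filter.Tendsto (fun t : ℝ => AffineMap.lineMap y x t) (nhdsWithin 0 (Set.Ioo 0 1))
      (nhds y) := by
    have := hc.tendsto 0
    rw [AffineMap.lineMap_apply_zero] at this
    exact this.mono_left nhdsWithin_le_nhds
  have : (nhdsWithin (0 : ℝ) (Set.Ioo 0 1)).NeBot := by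
    rw [← mem_closure_iff_nhdsWithin_neBot, closure_Ioo zero_ne_one]
    simp
  exact mem_closure_of_tendsto h0 (Filter.eventually_of_mem self_mem_nhdsWithin
    fun t ht => lineMap_mem_intrinsicInterior hC hy hx ht.1 ht.2)

theorem exists_sum_smul_eq_of_mem_convexHull_range {F ι : Type*} [AddCommGroup F] [Module ℝ F]
    [Fintype ι] {z : ι → F} {x : F} (hx : x ∈ convexHull ℝ (Set.range z)) :
    ∃ a : ι → ℝ, (∀ i, 0 ≤ a i) ∧ ∑ i, a i = 1 ∧ ∑ i, a i • z i = x := by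
  classical
  rw [convexHull_range_eq_exists_affineCombination] at hx
  obtain ⟨s, a, ha0, ha1, rfl⟩ := hx
  refine ⟨fun i => if i ∈ s then a i else 0, fun i => ?_, ?_, ?_⟩
  · dsimp only
    split_ifs with h
    exacts [ha0 i h, le_rfl]
  · rw [Finset.sum_ite_mem, Finset.univ_inter, ha1]
  · rw [s.affineCombination_eq_linear_combination _ _ ha1]
    simp [ite_smul, Finset.sum_ite_mem]

/-- The weights are positive, so a small multiple of any relative interior point can be split off,
which puts the sum on an open segment ending at that point. -/
theorem sum_smul_mem_intrinsicInterior_convexHull {F ι : Type*} [NormedAddCommGroup F]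
    [NormedSpace ℝ F] [FiniteDimensional ℝ F] [Fintype ι] (z : ι → F)
    {w : ι → ℝ} (hw : ∀ i, 0 < w i) (hw1 : ∑ i, w i = 1) :
    ∑ i, w i • z i ∈ intrinsicInterior ℝ (convexHull ℝ (Set.range z)) := by
  have hne : Nonempty ι := by
    by_contra h
    rw [not_nonempty_iff] at h
    simp at hw1
  obtain ⟨x, hx⟩ := Set.Nonempty.intrinsicInterior (convex_convexHull ℝ (Set.range z))
    (Set.range_nonempty z).convexHull
  have hxC := intrinsicInterior_subset hx
  obtain ⟨a, ha0, ha1, hax⟩ := exists_sum_smul_eq_of_mem_convexHull_range hxC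
  obtain ⟨i₀, hi₀⟩ := Finite.exists_min w
  have hw₀ := hw i₀
  have hle : ∀ {b : ι → ℝ}, (∀ i, 0 ≤ b i) → ∑ i, b i = 1 → ∀ i, b i ≤ 1 := fun h0 h1 i =>
    (Finset.single_le_sum (fun j _ => h0 j) (Finset.mem_univ i)).trans_eq h1
  have hw₁ := hle (fun i => (hw i).le) hw1 i₀
  -- Half the least weight: `t * a i ≤ w i` because `a i ≤ 1`, and `t < 1`.
  set t := w i₀ / 2 with ht
  have ht1 : 0 < 1 - t := by linarith
  have hy : ∑ i, ((w i - t * a i) / (1 - t)) • z i ∈ convexHull ℝ (Set.range z) := by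
    refine (convex_convexHull ℝ _).sum_mem (fun i _ => div_nonneg ?_ ht1.le) ?_
      fun i _ => subset_convexHull ℝ _ ⟨i, rfl⟩
    · have := mul_le_mul_of_nonneg_left (hle ha0 ha1 i) (half_pos hw₀).le
      have := hi₀ i
      rw [ht]
      linarith
    · rw [← Finset.sum_div, Finset.sum_sub_distrib, ← Finset.mul_sum, hw1, ha1, mul_one,
        div_self ht1.ne']
  convert lineMap_mem_intrinsicInterior (convex_convexHull ℝ _) hy hx (half_pos hw₀)
    (by linarith : w i₀ / 2 < 1) using 1
  rw [AffineMap.lineMap_apply_module, ← ht, ← hax, Finset.smul_sum, Finset.smul_sum,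
    ← Finset.sum_add_distrib]
  refine Finset.sum_congr rfl fun i _ => ?_
  rw [smul_smul, smul_smul, ← add_smul, mul_div_cancel₀ _ ht1.ne', sub_add_cancel]

theorem affineSpan_eq_of_subset_of_finrank {F : Type*} [NormedAddCommGroup F]
    [NormedSpace ℝ F] [FiniteDimensional ℝ F] {s t : Set F} (hst : s ⊆ t) (hs : s.Nonempty)
    (h : Module.finrank ℝ (vectorSpan ℝ t) ≤ Module.finrank ℝ (vectorSpan ℝ s)) :
    affineSpan ℝ s = affineSpan ℝ t := by
  have hle := affineSpan_mono ℝ hst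
  refine AffineSubspace.eq_of_direction_eq_of_nonempty_of_le ?_ ((affineSpan_nonempty ℝ).2 hs) hle
  rw [direction_affineSpan, direction_affineSpan]
  exact Submodule.eq_of_le_of_finrank_le (vectorSpan_mono ℝ hst) h

/-- Each convex piece has full dimension, hence the affine span of `S`, so its relative interior
lies in that of `S`. -/
theorem IsPolytope.subset_closure_intrinsicInterior {d n : ℕ} {S : Set (E d)}
    (h : IsPolytope n S) : S ⊆ closure (intrinsicInterior ℝ S) := by
  obtain ⟨F, hF, hS⟩ := h.exists_pieces
  intro y hy
  rw [hS] at hy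
  obtain ⟨P, hP, hyP⟩ := Set.mem_iUnion₂.1 hy
  have hPS : convexHull ℝ (P : Set (E d)) ⊆ S := by
    rw [hS]
    exact Set.subset_biUnion_of_mem
      (u := fun P : Finset (E d) => convexHull ℝ (P : Set (E d))) hP
  have hA : affineSpan ℝ (convexHull ℝ (P : Set (E d))) = affineSpan ℝ S := by
    refine affineSpan_eq_of_subset_of_finrank hPS ⟨y, hyP⟩ ?_
    rw [h.finrank_vectorSpan, ← direction_affineSpan _ (convexHull ℝ _), affineSpan_convexHull,
      direction_affineSpan, hF P hP]
  refine closure_mono ?_ (WG.subset_closure_intrinsicInterior (convex_convexHull ℝ _) hyP)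
  intro x hx
  rw [mem_intrinsicInterior_iff_exists_isOpen, hA] at *
  obtain ⟨hx, U, hU, hxU, h⟩ := hx
  exact ⟨hx, U, hU, hxU, h.trans hPS⟩

theorem IsPolytope.affineSpan_eq_top {d : ℕ} {S : Set (E d)} (h : IsPolytope d S) :
    affineSpan ℝ S = ⊤ := by
  have hne : S.Nonempty := h.isConnected_interior.nonempty.mono (intrinsicInterior_subset (𝕜 := ℝ))
  rw [AffineSubspace.affineSpan_eq_top_iff_vectorSpan_eq_top_of_nonempty ℝ _ _ hne]
  refine Submodule.eq_top_of_finrank_eq ?_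
  rw [h.finrank_vectorSpan, finrank_euclideanSpace_fin]

theorem IsPolytope.intrinsicInterior_eq_interior {d : ℕ} {S : Set (E d)} (h : IsPolytope d S) :
    intrinsicInterior ℝ S = interior S := by
  ext x
  rw [mem_intrinsicInterior_iff_exists_isOpen, h.affineSpan_eq_top, mem_interior]
  simp only [AffineSubspace.top_coe, Set.inter_univ, AffineSubspace.mem_top, true_and]
  exact ⟨fun ⟨U, a, b, c⟩ => ⟨U, c, a, b⟩, fun ⟨U, a, b, c⟩ => ⟨U, b, c, a⟩⟩

theorem IsPolytope.subset_closure_interior {d : ℕ} {S : Set (E d)} (h : IsPolytope d S) :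
    S ⊆ closure (interior S) :=
  h.intrinsicInterior_eq_interior ▸ h.subset_closure_intrinsicInterior

theorem IsPolytope.nonempty_interior {d : ℕ} {S : Set (E d)} (h : IsPolytope d S) :
    (interior S).Nonempty :=
  h.intrinsicInterior_eq_interior ▸ h.isConnected_interior.nonempty

/-- The relative boundary of an `n`-dimensional polytope lies in finitely many affine subspaces of
dimension less than `n`. -/
theorem IsPolytope.exists_finset_diff_intrinsicInterior {d n : ℕ} {S : Set (E d)}
    (h : IsPolytope n S) : ∃ G : Finset (Finset (E d)), (∀ Q ∈ G, Q.card ≤ n) ∧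
      ∀ x ∈ S, x ∉ intrinsicInterior ℝ S → ∃ Q ∈ G, x ∈ affineSpan ℝ (Q : Set (E d)) := by
  classical
  obtain ⟨F, hF, hS⟩ := h.exists_pieces
  refine ⟨(F.biUnion fun P => P.powerset).filter fun Q => Q.card ≤ n,
    fun Q hQ => (Finset.mem_filter.1 hQ).2, fun x hx hxi => ?_⟩
  have hPS : ∀ P ∈ F, convexHull ℝ (P : Set (E d)) ⊆ S := fun P hP => by
    rw [hS]
    exact Set.subset_biUnion_of_mem
      (u := fun P : Finset (E d) => convexHull ℝ (P : Set (E d))) hP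
  rw [hS] at hx
  obtain ⟨P, hP, hxP⟩ := Set.mem_iUnion₂.1 hx
  -- By Carathéodory, `x` is relatively interior to a simplex on vertices of `P`. With more than `n`
  -- vertices the simplex would span `affineSpan ℝ S`, and `x` would be relatively interior to `S`.
  obtain ⟨ι, _, z, w, hz, hind, hw, hw1, rfl⟩ := eq_pos_convex_span_of_mem_convexHull hxP
  have hzx := sum_smul_mem_intrinsicInterior_convexHull z hw hw1
  have hzS : convexHull ℝ (Set.range z) ⊆ S := (convexHull_mono hz).trans (hPS P hP)
  have hcard : (Finset.univ.image z).card = Fintype.card ι :=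
    Finset.card_image_of_injective _ hind.injective
  refine ⟨Finset.univ.image z, ?_, ?_⟩
  · refine Finset.mem_filter.2 ⟨Finset.mem_biUnion.2 ⟨P, hP, Finset.mem_powerset.2 ?_⟩, ?_⟩
    · intro y hy
      obtain ⟨i, -, rfl⟩ := Finset.mem_image.1 hy
      exact hz ⟨i, rfl⟩
    · rw [hcard]
      by_contra! hlt
      apply hxi
      have hne : (Set.range z).Nonempty := by
        rw [Set.range_nonempty_iff_nonempty]
        exact Fintype.card_pos_iff.1 (by omega)
      have hA : affineSpan ℝ (Set.range z) = affineSpan ℝ S := by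
        refine affineSpan_eq_of_subset_of_finrank ((subset_convexHull ℝ _).trans hzS) hne ?_
        have := hind.finrank_vectorSpan (n := Fintype.card ι - 1) (by omega)
        rw [h.finrank_vectorSpan]
        omega
      rw [mem_intrinsicInterior_iff_exists_isOpen] at hzx ⊢
      rw [affineSpan_convexHull, hA] at hzx
      obtain ⟨hx, U, hU, hxU, h⟩ := hzx
      exact ⟨hx, U, hU, hxU, h.trans hzS⟩
  · have := intrinsicInterior_subset hzx
    rw [Finset.coe_image, Finset.coe_univ, Set.image_univ]
    exact convexHull_subset_affineSpan _ this

/-! ### Segments and points in general position -/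

/-- A segment between points of two open sets can be chosen off finitely many affine subspaces of
codimension two. -/
theorem exists_segment_forall_notMem_affineSpan {d : ℕ} (hd : 1 ≤ d) {U V : Set (E d)}
    (hU : IsOpen U) (hUne : U.Nonempty) (hV : IsOpen V) (hVne : V.Nonempty)
    (G : Finset (Finset (E d))) (hG : ∀ Q ∈ G, Q.card ≤ d - 1) :
    ∃ p ∈ U, ∃ q ∈ V, ∀ x ∈ segment ℝ p q, ∀ Q ∈ G, x ∉ affineSpan ℝ (Q : Set (E d)) := by
  -- At most `d` points span dimension at most `d - 1`.
  have key : ∀ p : E d, ∀ Q ∈ G, affineSpan ℝ (insert p (Q : Set (E d))) ≠ ⊤ := by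
    classical
    intro p Q hQ htop
    have h1 := congrArg AffineSubspace.direction htop
    rw [direction_affineSpan, AffineSubspace.direction_top] at h1
    have h2 : Module.finrank ℝ (vectorSpan ℝ (insert p (Q : Set (E d)))) = d := by
      rw [h1, finrank_top, finrank_euclideanSpace_fin]
    have h3 := finrank_vectorSpan_image_finset_le ℝ (id : E d → E d) (insert p Q)
      (n := (insert p Q).card - 1)
      (by have := (Finset.insert_nonempty p Q).card_pos; omega)
    rw [Finset.image_id, Finset.coe_insert] at h3
    have h4 := Finset.card_insert_le p Q
    have h5 := hG Q hQ
    omega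
  obtain ⟨p, hp, hpG⟩ := exists_mem_forall_notMem_affineSubspace hU hUne G
    (fun Q => affineSpan ℝ (Q : Set (E d))) fun Q hQ h => key 0 Q hQ
      (top_le_iff.1 (h ▸ affineSpan_mono ℝ (Set.subset_insert _ _)))
  -- If the segment met the span of `Q` away from `p`, the line through `p` and that point would put
  -- `q` in the span of `Q` and `p`.
  obtain ⟨q, hq, hqG⟩ := exists_mem_forall_notMem_affineSubspace hV hVne G
    (fun Q => affineSpan ℝ (insert p (Q : Set (E d)))) fun Q hQ => key p Q hQ
  refine ⟨p, hp, q, hq, fun x hx Q hQ hxQ => ?_⟩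
  rw [segment_eq_image_lineMap] at hx
  obtain ⟨t, -, rfl⟩ := hx
  rcases eq_or_ne t 0 with rfl | ht
  · exact hpG Q hQ (by simpa using hxQ)
  · refine hqG Q hQ ?_
    have h1 : AffineMap.lineMap p q t ∈ affineSpan ℝ (insert p (Q : Set (E d))) :=
      affineSpan_mono ℝ (Set.subset_insert _ _) hxQ
    have h2 := AffineMap.lineMap_mem t⁻¹ (mem_affineSpan ℝ (Set.mem_insert p (Q : Set (E d)))) h1
    have h3 : AffineMap.lineMap p (AffineMap.lineMap p q t) t⁻¹ = q := by
      simp [AffineMap.lineMap_apply, smul_smul, inv_mul_cancel₀ ht]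
    rwa [h3] at h2

theorem exists_mem_intrinsicInterior_forall_notMem_affineSpan {d n : ℕ} {S : Set (E d)}
    (h : IsPolytope n S) {y : E d} (hy : y ∈ S) {V : Set (E d)} (hV : IsOpen V) (hyV : y ∈ V)
    (G : Finset (Finset (E d))) (hG : ∀ Q ∈ G, Q.card ≤ n) :
    ∃ x ∈ V, x ∈ intrinsicInterior ℝ S ∧ ∀ Q ∈ G, x ∉ affineSpan ℝ (Q : Set (E d)) := by
  obtain ⟨x₀, hx₀V, hx₀⟩ := mem_closure_iff.1 (h.subset_closure_intrinsicInterior hy) V hV hyV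
  obtain ⟨hx₀S, U, hU, hx₀U, hUS⟩ := mem_intrinsicInterior_iff_exists_isOpen.1 hx₀
  obtain ⟨x, hx, hxS, hxG⟩ := exists_mem_inter_forall_notMem_affineSubspace (hU.inter hV)
    (affineSpan ℝ S) ⟨hx₀U, hx₀V⟩ hx₀S G (fun Q => affineSpan ℝ (Q : Set (E d)))
    fun Q hQ hle => by
      classical
      -- For empty `Q` the subtraction in `Q.card - 1` would truncate.
      rcases Q.eq_empty_or_nonempty with rfl | hQne
      · have := hle hx₀S
        rw [Finset.coe_empty, AffineSubspace.span_empty] at this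
        exact AffineSubspace.notMem_bot ℝ _ _ this
      have h1 := Submodule.finrank_mono (AffineSubspace.direction_le hle)
      rw [direction_affineSpan, direction_affineSpan, h.finrank_vectorSpan] at h1
      have h3 := finrank_vectorSpan_image_finset_le ℝ (id : E d → E d) Q (n := Q.card - 1)
        (by have := hQne.card_pos; omega)
      rw [Finset.image_id] at h3
      have := hG Q hQ
      have := hQne.card_pos
      omega
  exact ⟨x, hx.2, mem_intrinsicInterior_iff_exists_isOpen.2 ⟨hxS, U, hU, hx.1, hUS⟩, hxG⟩

/-! ### Closed sets with locally flat boundary -/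

theorem subset_interior_or_disjoint_of_disjoint_frontier {X : Type*} [TopologicalSpace X]
    {s T : Set X} (hs : IsPreconnected s) (hT : IsClosed T) (h : Disjoint s (frontier T)) :
    s ⊆ interior T ∨ Disjoint s T := by
  rw [← Set.subset_compl_iff_disjoint_right]
  refine hs.subset_or_subset isOpen_interior hT.isOpen_compl
    (disjoint_compl_right.mono_left interior_subset) fun x hx => ?_
  by_cases hxT : x ∈ T
  · refine Or.inl (by_contra fun hxi => Set.disjoint_left.1 h hx ?_)
    rw [hT.frontier_eq]
    exact ⟨hxT, hxi⟩
  · exact Or.inr hxT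

theorem exists_pos_add_smul_mem {F : Type*} [NormedAddCommGroup F] [NormedSpace ℝ F]
    {U : Set F} (hU : IsOpen U) {y : F} (hy : y ∈ U) (n : F) : ∃ t : ℝ, 0 < t ∧ y + t • n ∈ U := by
  have hc : Continuous fun t : ℝ => y + t • n := by fun_prop
  have h0 : ∀ᶠ t in nhds (0 : ℝ), y + t • n ∈ U :=
    hc.continuousAt.eventually (by simpa using hU.mem_nhds hy)
  obtain ⟨t, ht, ht0⟩ := ((h0.filter_mono nhdsWithin_le_nhds).and
    (self_mem_nhdsWithin (a := (0 : ℝ)) (s := Set.Ioi 0))).exists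
  exact ⟨t, ht0, ht⟩

/-- The open half of a ball on the side of `n` of the hyperplane through its centre orthogonal
to `n`. -/
def halfBall {d : ℕ} (z : E d) (r : ℝ) (n : E d) : Set (E d) :=
  {y ∈ Metric.ball z r | 0 < inner ℝ n (y - z)}

theorem convex_halfBall {d : ℕ} (z : E d) (r : ℝ) (n : E d) : Convex ℝ (halfBall z r n) := by
  refine (convex_ball z r).inter ?_
  have : {y : E d | 0 < inner ℝ n (y - z)} = {y | inner ℝ n z < innerSL ℝ n y} := by
    ext y
    simp [inner_sub_right]
  show Convex ℝ {y : E d | 0 < inner ℝ n (y - z)}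
  rw [this]
  exact convex_halfSpace_gt (innerSL ℝ n).toLinearMap.isLinear _

theorem add_smul_mem_halfBall {d : ℕ} {z n y : E d} {r t : ℝ} (hn : n ≠ 0) (ht : 0 < t)
    (hy : inner ℝ n (y - z) = 0) (hyt : y + t • n ∈ Metric.ball z r) :
    y + t • n ∈ halfBall z r n := by
  refine ⟨hyt, ?_⟩
  rw [add_sub_right_comm, inner_add_right, hy, inner_smul_right, zero_add]
  exact mul_pos ht (real_inner_self_pos.2 hn)

theorem halfBall_nonempty {d : ℕ} (z : E d) {r : ℝ} (hr : 0 < r) {n : E d} (hn : n ≠ 0) :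
    (halfBall z r n).Nonempty := by
  obtain ⟨t, ht, h⟩ := exists_pos_add_smul_mem Metric.isOpen_ball (Metric.mem_ball_self hr) n
  exact ⟨_, add_smul_mem_halfBall hn ht (by simp) h⟩

/-- Points of the dividing hyperplane are limits of points of a half-ball. -/
theorem ball_subset_of_halfBall_subset {d : ℕ} {z n : E d} {r : ℝ} (hn : n ≠ 0)
    {K : Set (E d)} (hK : IsClosed K) (h : halfBall z r n ⊆ K) (h' : halfBall z r (-n) ⊆ K) :
    Metric.ball z r ⊆ K := by
  intro y hy
  rcases lt_trichotomy (inner ℝ n (y - z)) 0 with hlt | heq | hgt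
  · exact h' ⟨hy, by rw [inner_neg_left]; linarith⟩
  · by_contra hyK
    obtain ⟨t, ht, htK⟩ := exists_pos_add_smul_mem (Metric.isOpen_ball.inter hK.isOpen_compl)
      ⟨hy, hyK⟩ n
    exact htK.2 (h (add_smul_mem_halfBall hn ht heq htK.1))
  · exact h ⟨hy, hgt⟩

/-- If the boundary of a closed set is flat near one of its points, then the set contains one of
the two sides. -/
theorem halfBall_subset_interior {d : ℕ} {T : Set (E d)} (hT : IsClosed T)
    (hTi : T ⊆ closure (interior T)) {z n : E d} {r : ℝ} (hr : 0 < r) (hn : n ≠ 0) (hz : z ∈ T)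
    (hf : ∀ y ∈ frontier T, y ∈ Metric.ball z r → inner ℝ n (y - z) = 0) :
    halfBall z r n ⊆ interior T ∨ halfBall z r (-n) ⊆ interior T := by
  have key : ∀ m, (m = n ∨ m = -n) → halfBall z r m ⊆ interior T ∨ Disjoint (halfBall z r m) T := by
    intro m hm
    refine subset_interior_or_disjoint_of_disjoint_frontier (convex_halfBall z r m).isPreconnected
      hT (Set.disjoint_left.2 fun y hy hyf => ?_)
    have h0 := hf y hyf hy.1
    have h1 := hy.2
    rcases hm with rfl | rfl
    · exact h1.ne' h0
    · rw [inner_neg_left, h0, neg_zero] at h1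
      exact lt_irrefl _ h1
  rcases key n (Or.inl rfl) with h | h
  · exact Or.inl h
  rcases key (-n) (Or.inr rfl) with h' | h'
  · exact Or.inr h'
  -- If both halves miss `T`, the whole ball misses `interior T`, although `z` is in its closure.
  exfalso
  obtain ⟨y, hyB, hyT⟩ := mem_closure_iff.1 (hTi hz) _ Metric.isOpen_ball (Metric.mem_ball_self hr)
  have hball := ball_subset_of_halfBall_subset (z := z) (r := r) hn
    (K := (interior T)ᶜ) isOpen_interior.isClosed_compl
    (fun x hx hxT => Set.disjoint_left.1 h hx (interior_subset hxT))
    (fun x hx hxT => Set.disjoint_left.1 h' hx (interior_subset hxT))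
  exact hball hyB hyT

theorem exists_ne_zero_forall_mem_inner_sub_eq_zero {d : ℕ} (hd : 1 ≤ d) {e : Set (E d)}
    (he : IsPolytope (d - 1) e) :
    ∃ n : E d, n ≠ 0 ∧ ∀ x ∈ e, ∀ y ∈ e, inner ℝ n (y - x) = 0 := by
  have hne : (vectorSpan ℝ e)ᗮ ≠ ⊥ := by
    rw [Ne, Submodule.orthogonal_eq_bot_iff]
    intro h
    have := he.finrank_vectorSpan
    rw [h, finrank_top, finrank_euclideanSpace_fin] at this
    omega
  obtain ⟨n, hn, hn0⟩ := Submodule.exists_mem_ne_zero_of_ne_bot hne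
  exact ⟨n, hn0, fun x hx y hy =>
    (Submodule.mem_orthogonal' _ _).1 hn _ (vsub_mem_vectorSpan ℝ hy hx)⟩

/-! ### Adjacency of elements and faces on the boundary -/

namespace Partition

variable {d : ℕ} {Ω : Set (E d)} (𝒯 : Partition Ω)

/-- The relative boundaries of the faces lie in finitely many affine subspaces of codimension
two. -/
theorem exists_finset_diff_intrinsicInterior : ∃ G : Finset (Finset (E d)),
    (∀ Q ∈ G, Q.card ≤ d - 1) ∧ ∀ e ∈ 𝒯.faces, ∀ x ∈ e,
      (∀ Q ∈ G, x ∉ affineSpan ℝ (Q : Set (E d))) → x ∈ intrinsicInterior ℝ e := by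
  classical
  choose! G hG hGx using fun e (he : e ∈ 𝒯.faces) =>
    (𝒯.isPolytope_face e he).exists_finset_diff_intrinsicInterior
  refine ⟨𝒯.faces.biUnion G, fun Q hQ => ?_, fun e he x hx h => by_contra fun hxi => ?_⟩
  · obtain ⟨e, he, hQ⟩ := Finset.mem_biUnion.1 hQ
    exact hG e he Q hQ
  · obtain ⟨Q, hQ, hxQ⟩ := hGx e he x hx hxi
    exact h Q (Finset.mem_biUnion.2 ⟨e, he, hQ⟩) hxQ

variable {𝒯}

theorem isClosed_cell {T : Set (E d)} (hT : T ∈ 𝒯.cells) : IsClosed T :=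
  (𝒯.isPolytope_cell T hT).isCompact.isClosed

/-- `T'` is in the closure of its interior, so a point of `T'` interior to `T` would make the two
interiors meet. -/
theorem mem_frontier_of_mem_of_ne {T T' : Set (E d)} (hT : T ∈ 𝒯.cells) (hT' : T' ∈ 𝒯.cells)
    (hne : T ≠ T') {x : E d} (hx : x ∈ T) (hx' : x ∈ T') : x ∈ frontier T := by
  rw [(isClosed_cell hT).frontier_eq]
  refine ⟨hx, fun hxi => ?_⟩
  obtain ⟨y, hy, hy'⟩ := mem_closure_iff.1 ((𝒯.isPolytope_cell T' hT').subset_closure_interior hx')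
    _ isOpen_interior hxi
  exact Set.disjoint_left.1 (𝒯.disjoint_cells T hT T' hT' hne) hy hy'

theorem exists_face_of_mem_frontier {T : Set (E d)} (hT : T ∈ 𝒯.cells) {x : E d}
    (hx : x ∈ frontier T) : ∃ e ∈ 𝒯.faces, e ⊆ frontier T ∧ x ∈ e := by
  rw [𝒯.frontier_cell T hT] at hx
  obtain ⟨e, he, hx⟩ := Set.mem_iUnion₂.1 hx
  obtain ⟨heT, hx⟩ := Set.mem_iUnion.1 hx
  exact ⟨e, he, heT, hx⟩

theorem face_eq_of_mem_intrinsicInterior {e e' : Set (E d)} (he : e ∈ 𝒯.faces)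
    (he' : e' ∈ 𝒯.faces) {x : E d} (hx : x ∈ intrinsicInterior ℝ e)
    (hx' : x ∈ intrinsicInterior ℝ e') : e = e' :=
  by_contra fun h => Set.disjoint_left.1 (𝒯.disjoint_faces e he e' he' h) hx hx'

theorem cell_inter_nonempty {T : Set (E d)} (hT : T ∈ 𝒯.cells) : (Ω ∩ T).Nonempty := by
  obtain ⟨x, hx⟩ := (𝒯.isPolytope_cell T hT).nonempty_interior
  have hxΩ : x ∈ closure Ω := by
    rw [← 𝒯.iUnion_cells]
    exact Set.mem_biUnion hT (interior_subset hx)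
  obtain ⟨y, hy, hyΩ⟩ := mem_closure_iff.1 hxΩ _ isOpen_interior hx
  exact ⟨y, hyΩ, interior_subset hy⟩

/-- Any two elements are joined by a chain of elements in which neighbours share a face. -/
theorem forall_cell_of_forall_shared_face (hd : 1 ≤ d) (hΩo : IsOpen Ω) (hΩc : IsConnected Ω)
    (p : Set (E d) → Prop)
    (hp : ∀ T ∈ 𝒯.cells, ∀ T' ∈ 𝒯.cells, ∀ e ∈ 𝒯.faces, e ⊆ frontier T → e ⊆ frontier T' →
      p T → p T')
    {T₀ : Set (E d)} (hT₀ : T₀ ∈ 𝒯.cells) (hpT₀ : p T₀) : ∀ T ∈ 𝒯.cells, p T := by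
  by_contra! hcon
  obtain ⟨T₁, hT₁, hpT₁⟩ := hcon
  obtain ⟨G, hG, hGi⟩ := 𝒯.exists_finset_diff_intrinsicInterior
  have hfin : ∀ q : Set (E d) → Prop, {T ∈ (𝒯.cells : Set (Set (E d))) | q T}.Finite :=
    fun q => 𝒯.cells.finite_toSet.subset fun T hT => hT.1
  have hcl : ∀ q : Set (E d) → Prop,
      IsClosed (⋃ T ∈ {T ∈ (𝒯.cells : Set (Set (E d))) | q T}, T) :=
    fun q => (hfin q).isClosed_biUnion fun T hT => isClosed_cell hT.1
  set X := ⋃ T ∈ {T ∈ (𝒯.cells : Set (Set (E d))) | p T}, T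
  set Y := ⋃ T ∈ {T ∈ (𝒯.cells : Set (Set (E d))) | ¬ p T}, T
  have hX : ∀ {T x}, T ∈ 𝒯.cells → p T → x ∈ T → x ∈ X := fun hT h hx =>
    Set.mem_biUnion (show _ ∈ {T ∈ (𝒯.cells : Set (Set (E d))) | p T} from ⟨hT, h⟩) hx
  have hY : ∀ {T x}, T ∈ 𝒯.cells → ¬ p T → x ∈ T → x ∈ Y := fun hT h hx =>
    Set.mem_biUnion (show _ ∈ {T ∈ (𝒯.cells : Set (Set (E d))) | ¬ p T} from ⟨hT, h⟩) hx
  have hXY : Ω ⊆ X ∪ Y := fun x hx => by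
    have := subset_closure hx
    rw [← 𝒯.iUnion_cells] at this
    obtain ⟨T, hT, hxT⟩ := Set.mem_iUnion₂.1 this
    by_cases h : p T
    exacts [Or.inl (hX hT h hxT), Or.inr (hY hT h hxT)]
  -- Connectedness of `Ω` gives a point common to both families, but possibly on the relative
  -- boundary of a face. A segment in general position inside a ball around `x` then yields a better
  -- point `z`.
  obtain ⟨x, hxΩ, hxX, hxY⟩ := isPreconnected_closed_iff.1 hΩc.isPreconnected X Y (hcl _) (hcl _)
    hXY ((cell_inter_nonempty hT₀).mono (Set.inter_subset_inter_right _ fun x => hX hT₀ hpT₀))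
    ((cell_inter_nonempty hT₁).mono (Set.inter_subset_inter_right _ fun x => hY hT₁ hpT₁))
  obtain ⟨T, ⟨hT, hpT⟩, hxT⟩ := Set.mem_iUnion₂.1 hxX
  obtain ⟨T', ⟨hT', hpT'⟩, hxT'⟩ := Set.mem_iUnion₂.1 hxY
  obtain ⟨r, hr, hrΩ⟩ := Metric.isOpen_iff.1 hΩo x hxΩ
  have hne : ∀ {T}, T ∈ 𝒯.cells → x ∈ T → (Metric.ball x r ∩ interior T).Nonempty :=
    fun hT hx => mem_closure_iff.1 ((𝒯.isPolytope_cell _ hT).subset_closure_interior hx) _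
      Metric.isOpen_ball (Metric.mem_ball_self hr)
  obtain ⟨a, ha, b, hb, hab⟩ := exists_segment_forall_notMem_affineSpan hd
    (Metric.isOpen_ball.inter isOpen_interior) (hne hT hxT)
    (Metric.isOpen_ball.inter isOpen_interior) (hne hT' hxT') G hG
  have hseg : segment ℝ a b ⊆ Ω := ((convex_ball x r).segment_subset ha.1 hb.1).trans hrΩ
  obtain ⟨z, hz, hzX, hzY⟩ := isPreconnected_closed_iff.1
    (convex_segment a b).isPreconnected X Y (hcl _) (hcl _) (hseg.trans hXY)
    ⟨a, left_mem_segment ℝ a b, hX hT hpT (interior_subset ha.2)⟩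
    ⟨b, right_mem_segment ℝ a b, hY hT' hpT' (interior_subset hb.2)⟩
  obtain ⟨S, ⟨hS, hpS⟩, hzS⟩ := Set.mem_iUnion₂.1 hzX
  obtain ⟨S', ⟨hS', hpS'⟩, hzS'⟩ := Set.mem_iUnion₂.1 hzY
  have hSS' : S ≠ S' := fun h => hpS' (h ▸ hpS)
  obtain ⟨e, he, heS, hze⟩ :=
    exists_face_of_mem_frontier hS (mem_frontier_of_mem_of_ne hS hS' hSS' hzS hzS')
  obtain ⟨e', he', heS', hze'⟩ :=
    exists_face_of_mem_frontier hS' (mem_frontier_of_mem_of_ne hS' hS hSS'.symm hzS' hzS)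
  obtain rfl := face_eq_of_mem_intrinsicInterior he he' (hGi e he z hze (hab z hz))
    (hGi e' he' z hze' (hab z hz))
  exact hpS' (hp S hS S' hS' e he heS heS' hpS)

/-- A regular point of a face that belongs to two elements is interior to their union. -/
theorem mem_interior_closure_of_mem_two_cells (hd : 1 ≤ d) {z : E d} {e T T' : Set (E d)}
    (hT : T ∈ 𝒯.cells) (hT' : T' ∈ 𝒯.cells) (hne : T ≠ T') (hzT : z ∈ T) (hzT' : z ∈ T')
    (he : e ∈ 𝒯.faces) (hze : z ∈ e) (huniq : ∀ e' ∈ 𝒯.faces, z ∈ e' → e' = e) :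
    z ∈ interior (closure Ω) := by
  obtain ⟨n, hn, hne'⟩ := exists_ne_zero_forall_mem_inner_sub_eq_zero hd (𝒯.isPolytope_face e he)
  have hcl : IsClosed (⋃ e' ∈ {e' ∈ (𝒯.faces : Set (Set (E d))) | z ∉ e'}, e') :=
    (𝒯.faces.finite_toSet.subset fun e' he' => he'.1).isClosed_biUnion fun e' he' =>
      (𝒯.isPolytope_face e' he'.1).isCompact.isClosed
  -- The ball meets no face but `e`, so inside it all element boundaries lie in the hyperplane of
  -- `e`.
  obtain ⟨r, hr, hball⟩ := Metric.isOpen_iff.1 hcl.isOpen_compl z (by simp)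
  have hflat : ∀ S ∈ 𝒯.cells, ∀ y ∈ frontier S, y ∈ Metric.ball z r → inner ℝ n (y - z) = 0 := by
    intro S hS y hy hyB
    obtain ⟨e', he', -, hye'⟩ := exists_face_of_mem_frontier hS hy
    have hze' : z ∈ e' := by
      by_contra hze'
      exact hball hyB (Set.mem_biUnion
        (show e' ∈ {e' ∈ (𝒯.faces : Set (Set (E d))) | z ∉ e'} from ⟨he', hze'⟩) hye')
    obtain rfl := huniq e' he' hze'
    exact hne' z hze y hye'
  have hhalf : ∀ S ∈ 𝒯.cells, z ∈ S →
      halfBall z r n ⊆ interior S ∨ halfBall z r (-n) ⊆ interior S := fun S hS hzS =>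
    halfBall_subset_interior (isClosed_cell hS) (𝒯.isPolytope_cell S hS).subset_closure_interior
      hr hn hzS (hflat S hS)
  have hdisj : ∀ m : E d, m ≠ 0 → halfBall z r m ⊆ interior T → ¬ halfBall z r m ⊆ interior T' := by
    intro m hm h h'
    obtain ⟨y, hy⟩ := halfBall_nonempty z hr hm
    exact Set.disjoint_left.1 (𝒯.disjoint_cells T hT T' hT' hne) (h hy) (h' hy)
  have hsub : ∀ S ∈ 𝒯.cells, interior S ⊆ closure Ω := fun S hS x hx => by
    rw [← 𝒯.iUnion_cells]
    exact Set.mem_biUnion hS (interior_subset hx)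
  refine mem_interior.2 ⟨Metric.ball z r, ?_, Metric.isOpen_ball, Metric.mem_ball_self hr⟩
  -- Disjoint interiors force `T` and `T'` onto opposite sides, and together they fill the ball.
  rcases hhalf T hT hzT with h | h <;> rcases hhalf T' hT' hzT' with h' | h'
  · exact absurd h' (hdisj n hn h)
  · exact ball_subset_of_halfBall_subset hn isClosed_closure (h.trans (hsub T hT))
      (h'.trans (hsub T' hT'))
  · exact ball_subset_of_halfBall_subset hn isClosed_closure (h'.trans (hsub T' hT'))
      (h.trans (hsub T hT))
  · exact absurd h' (hdisj (-n) (neg_ne_zero.2 hn) h)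

/-- Some element has a face on the boundary of the domain. -/
theorem exists_face_subset_frontier (hd : 1 ≤ d) (hΩo : IsOpen Ω) (hΩb : Bornology.IsBounded Ω)
    (hΩc : IsConnected Ω) (𝒯 : Partition Ω) :
    ∃ T ∈ 𝒯.cells, ∃ e ∈ 𝒯.faces, e ⊆ frontier T ∧ e ⊆ frontier Ω := by
  obtain ⟨G, hG, hGi⟩ := 𝒯.exists_finset_diff_intrinsicInterior
  have huniq : ∀ {x : E d}, (∀ Q ∈ G, x ∉ affineSpan ℝ (Q : Set (E d))) → ∀ {e e' : Set (E d)},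
      e ∈ 𝒯.faces → e' ∈ 𝒯.faces → x ∈ e → x ∈ e' → e' = e := fun hx _ _ he he' hxe hxe' =>
    face_eq_of_mem_intrinsicInterior he' he (hGi _ he' _ hxe' hx) (hGi _ he _ hxe hx)
  have : Nonempty (Fin d) := ⟨⟨0, hd⟩⟩
  have hcompl : ((closure Ω)ᶜ).Nonempty := by
    rw [Set.nonempty_compl]
    intro h
    have := hΩb.isCompact_closure
    rw [h] at this
    exact noncompact_univ (E d) this
  obtain ⟨a, ha, b, hb, hab⟩ := exists_segment_forall_notMem_affineSpan hd hΩo hΩc.nonempty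
    isClosed_closure.isOpen_compl hcompl G hG
  -- The elements see only `closure Ω`, whose frontier can be smaller than that of `Ω`.
  obtain ⟨z, hz, hzf⟩ : (segment ℝ a b ∩ frontier (closure Ω)).Nonempty := by
    by_contra hcon
    rcases subset_interior_or_disjoint_of_disjoint_frontier (convex_segment a b).isPreconnected
      isClosed_closure (Set.disjoint_iff_inter_eq_empty.2 (Set.not_nonempty_iff_eq_empty.1 hcon))
      with h | h
    · exact hb (interior_subset (h (right_mem_segment ℝ a b)))
    · exact Set.disjoint_left.1 h (left_mem_segment ℝ a b) (subset_closure ha)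
  have hzG := hab z hz
  rw [isClosed_closure.frontier_eq] at hzf
  have hzK := hzf.1
  rw [← 𝒯.iUnion_cells] at hzK
  obtain ⟨T, hT, hzT⟩ := Set.mem_iUnion₂.1 hzK
  have hTK : T ⊆ closure Ω := by
    rw [← 𝒯.iUnion_cells]; exact fun x hx => Set.mem_biUnion hT hx
  have hzTf : z ∈ frontier T := by
    rw [(isClosed_cell hT).frontier_eq]
    exact ⟨hzT, fun h => hzf.2 (interior_mono hTK h)⟩
  obtain ⟨e, he, heT, hze⟩ := exists_face_of_mem_frontier hT hzTf
  have hone : ∀ T' ∈ 𝒯.cells, z ∈ T' → T' = T := fun T' hT' hzT' => by_contra fun hne =>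
    hzf.2 (mem_interior_closure_of_mem_two_cells hd hT' hT hne hzT' hzT he hze
      fun e' he' hze' => huniq hzG he he' hze hze')
  refine ⟨T, hT, e, he, heT, ?_⟩
  refine Set.Subset.trans ?_ (frontier_closure_subset (s := Ω))
  -- The frontier is closed, so it is enough to treat the points `y` of `e` in general position,
  -- which are dense in `e`.
  intro y₀ hy₀
  rw [← isClosed_frontier.closure_eq, mem_closure_iff]
  intro V hV hy₀V
  obtain ⟨y, hyV, hyi, hyG⟩ := exists_mem_intrinsicInterior_forall_notMem_affineSpan
    (𝒯.isPolytope_face e he) hy₀ hV hy₀V G hG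
  have hye := intrinsicInterior_subset hyi
  have hyT := (isClosed_cell hT).frontier_subset (heT hye)
  refine ⟨y, hyV, ?_⟩
  rw [isClosed_closure.frontier_eq]
  refine ⟨hTK hyT, fun hyK => ?_⟩
  have hcl : IsClosed (⋃ T' ∈ {T' ∈ (𝒯.cells : Set (Set (E d))) | y ∉ T'}, T') :=
    (𝒯.cells.finite_toSet.subset fun T' hT' => hT'.1).isClosed_biUnion fun T' hT' =>
      isClosed_cell hT'.1
  -- A second element at `y` would have `e` as a face, hence would contain `z` too.
  have hyone : ∀ T' ∈ 𝒯.cells, y ∈ T' → T' = T := by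
    intro T' hT' hyT'
    by_contra hne
    obtain ⟨e', he', he'T', hye'⟩ :=
      exists_face_of_mem_frontier hT' (mem_frontier_of_mem_of_ne hT' hT hne hyT' hyT)
    obtain rfl := huniq hyG he he' hye hye'
    exact hne (hone T' hT' ((isClosed_cell hT').frontier_subset (he'T' hze)))
  have hyf := heT hye
  rw [(isClosed_cell hT).frontier_eq] at hyf
  -- Near `y` the set `closure Ω` coincides with `T`, so `y` would be interior to `T`.
  refine hyf.2 (mem_interior.2 ⟨_, ?_, isOpen_interior.inter hcl.isOpen_compl, hyK, by simp⟩)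
  rintro x ⟨hxK, hx⟩
  have hxK := interior_subset hxK
  rw [← 𝒯.iUnion_cells] at hxK
  obtain ⟨T', hT', hxT'⟩ := Set.mem_iUnion₂.1 hxK
  by_cases hyT' : y ∈ T'
  · exact hyone T' hT' hyT' ▸ hxT'
  · exact absurd (Set.mem_biUnion
      (show T' ∈ {T' ∈ (𝒯.cells : Set (Set (E d))) | y ∉ T'} from ⟨hT', hyT'⟩) hxT') hx

end Partition

/-! ### Strain, rigid motions and traces -/

theorem contDiff_of_mem_polyField {d r : ℕ} {v : C(E d, E d)} (hv : v ∈ polyField d r) :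
    ContDiff ℝ ω v := by
  obtain ⟨p, -, hp⟩ := hv
  rw [contDiff_euclidean]
  intro i
  simp only [hp, contDiff_omega_iff_analyticOnNhd]
  have := AnalyticOnNhd.aeval_mvPolynomial (𝕜 := ℝ) (f := fun x : E d => fun j => x j)
    (s := Set.univ) (fun j => (EuclideanSpace.proj (𝕜 := ℝ) j).analyticOnNhd _) (p i)
  simpa only [MvPolynomial.aeval_eq_eval] using this

theorem contDiff_strain {d r : ℕ} {v : C(E d, E d)} (hv : v ∈ polyField d r) (i j : Fin d) :
    ContDiff ℝ ω fun x => strain v x i j := by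
  have h1 : ContDiff ℝ ω (fderiv ℝ v) :=
    (contDiff_of_mem_polyField hv).fderiv_right (by simp)
  have h2 : ∀ (a : E d) (l : Fin d), ContDiff ℝ ω fun x => fderiv ℝ v x a l := fun a l =>
    contDiff_euclidean.1 (h1.clm_apply contDiff_const) l
  exact ((h2 _ _).add (h2 _ _)).div_const 2

theorem strain_eq_zero_of_eqOn_isOpen {d r : ℕ} {v : C(E d, E d)} (hv : v ∈ polyField d r)
    {U : Set (E d)} (hU : IsOpen U) (hne : U.Nonempty) {i j : Fin d}
    (h : ∀ x ∈ U, strain v x i j = 0) (x : E d) : strain v x i j = 0 := by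
  obtain ⟨y, hy⟩ := hne
  have han : AnalyticOnNhd ℝ (fun x => strain v x i j) Set.univ :=
    (contDiff_strain hv i j).analyticOnNhd
  exact han.eqOn_zero_of_preconnected_of_eventuallyEq_zero isPreconnected_univ (Set.mem_univ y)
    (Filter.eventually_of_mem (hU.mem_nhds hy) h) (Set.mem_univ x)

/-- A quadratic form depends only on the symmetric part of its matrix. -/
theorem inner_fderiv_eq_sum_strain {d : ℕ} (v : C(E d, E d)) (x h : E d) :
    inner ℝ (fderiv ℝ v x h) h = ∑ i, ∑ j, h i * h j * strain v x i j := by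
  have hh : ∀ i, fderiv ℝ v x h i = ∑ j, h j * fderiv ℝ v x (EuclideanSpace.single j 1) i := by
    intro i
    have hsum : h = ∑ j, h j • EuclideanSpace.single j (1 : ℝ) := by
      ext i
      simp [Finset.sum_apply, Pi.single_apply]
    conv_lhs => rw [hsum]
    simp [map_sum]
  have h1 : inner ℝ (fderiv ℝ v x h) h =
      ∑ i, ∑ j, h i * h j * fderiv ℝ v x (EuclideanSpace.single j 1) i := by
    rw [PiLp.inner_apply]
    refine Finset.sum_congr rfl fun i _ => ?_
    simp only [hh, RCLike.inner_apply, conj_trivial, Finset.mul_sum, mul_assoc]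
  have h2 : inner ℝ (fderiv ℝ v x h) h =
      ∑ i, ∑ j, h i * h j * fderiv ℝ v x (EuclideanSpace.single i 1) j := by
    rw [h1, Finset.sum_comm]
    simp only [mul_comm (h _) (h _)]
  rw [← add_halves (inner ℝ (fderiv ℝ v x h) h), ← add_div]
  nth_rewrite 1 [h1]
  rw [h2, ← Finset.sum_add_distrib, Finset.sum_div]
  refine Finset.sum_congr rfl fun i _ => ?_
  rw [← Finset.sum_add_distrib, Finset.sum_div]
  refine Finset.sum_congr rfl fun j _ => ?_
  rw [strain]
  ring

/-- Along the segment from `y` to `x`, the component of `v` in the direction `x - y` has as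
derivative the quadratic form of the strain, which is zero. -/
theorem inner_sub_sub_eq_zero_of_strain_eq_zero {d : ℕ} {v : C(E d, E d)}
    (hv : Differentiable ℝ v) (hs : ∀ x i j, strain v x i j = 0) (x y : E d) :
    inner ℝ (v x - v y) (x - y) = 0 := by
  have hd : ∀ t : ℝ, HasDerivAt (fun t : ℝ => inner ℝ (v (y + t • (x - y))) (x - y)) 0 t := by
    intro t
    have h1 : HasDerivAt (fun t : ℝ => y + t • (x - y)) (x - y) t := by
      simpa using ((hasDerivAt_id t).smul_const (x - y)).const_add y
    have h2 := (hv (y + t • (x - y))).hasFDerivAt.comp_hasDerivAt t h1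
    have h3 := h2.inner ℝ (hasDerivAt_const t (x - y))
    rw [inner_zero_right, zero_add, inner_fderiv_eq_sum_strain] at h3
    simp only [hs, mul_zero, Finset.sum_const_zero] at h3
    exact h3
  have := is_const_of_deriv_eq_zero (fun t => (hd t).differentiableAt) (fun t => (hd t).deriv) 1 0
  simp only [one_smul, add_sub_cancel, zero_smul, add_zero] at this
  rw [inner_sub_left, this, sub_self]

/-- Polarization makes `L = v - v 0` skew for the inner product, and a skew map is automatically
linear. No second derivatives are needed. -/
theorem mem_rigidMotion_of_inner_sub_sub_eq_zero {d : ℕ} {v : C(E d, E d)}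
    (h : ∀ x y, inner ℝ (v x - v y) (x - y) = 0) : v ∈ rigidMotion d := by
  set L : E d → E d := fun x => v x - v 0 with hL
  have h0 : ∀ x, inner ℝ (L x) x = 0 := fun x => by simpa using h x 0
  have hskew : ∀ x y, inner ℝ (L x) y = -inner ℝ (L y) x := by
    intro x y
    have h1 : inner ℝ (L x - L y) (x - y) = 0 := by simpa [hL] using h x y
    rw [inner_sub_left, inner_sub_right, inner_sub_right, h0, h0] at h1
    linarith
  let Λ : E d →ₗ[ℝ] E d :=
    { toFun := L
      map_add' := fun x y => ext_inner_right ℝ fun z => by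
        rw [inner_add_left, hskew, hskew x, hskew y, inner_add_right]; ring
      map_smul' := fun c x => ext_inner_right ℝ fun z => by
        rw [RingHom.id_apply, inner_smul_left, hskew, hskew x, inner_smul_right]; simp }
  refine ⟨v 0, Matrix.toEuclideanLin.symm Λ, ?_, fun x => ?_⟩
  · have hη : ∀ i j, (Matrix.toEuclideanLin.symm Λ) i j = L (EuclideanSpace.single j 1) i := by
      intro i j
      have h2 : Matrix.toEuclideanLin (Matrix.toEuclideanLin.symm Λ) (EuclideanSpace.single j 1) =
        L (EuclideanSpace.single j 1) := by rw [LinearEquiv.apply_symm_apply]; rfl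
      rw [← h2]
      generalize Matrix.toEuclideanLin.symm Λ = M
      simp
    ext i j
    rw [Matrix.transpose_apply, Matrix.neg_apply, hη, hη]
    have := hskew (EuclideanSpace.single i 1) (EuclideanSpace.single j 1)
    simpa [EuclideanSpace.inner_single_right] using this
  · rw [LinearEquiv.apply_symm_apply]
    show v x = v 0 + (v x - v 0)
    abel

theorem inner_sub_sub_eq_zero_of_mem_rigidMotion {d : ℕ} {v : C(E d, E d)}
    (hv : v ∈ rigidMotion d) (x y : E d) : inner ℝ (v x - v y) (x - y) = 0 := by
  obtain ⟨a, η, hη, hv⟩ := hv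
  rw [hv, hv, add_sub_add_left_eq_sub, ← map_sub]
  set z := x - y
  have h1 : inner ℝ (Matrix.toEuclideanLin η z) z = ∑ i, ∑ j, z i * z j * η i j := by
    simp only [PiLp.inner_apply, Matrix.toLpLin_apply, Matrix.mulVec, dotProduct,
      RCLike.inner_apply, conj_trivial, Finset.mul_sum]
    exact Finset.sum_congr rfl fun i _ => Finset.sum_congr rfl fun j _ => by ring
  have h2 : inner ℝ (Matrix.toEuclideanLin η z) z = -∑ i, ∑ j, z i * z j * η i j := by
    rw [h1, ← Finset.sum_neg_distrib]
    conv_lhs => rw [Finset.sum_comm]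
    refine Finset.sum_congr rfl fun i _ => ?_
    rw [← Finset.sum_neg_distrib]
    refine Finset.sum_congr rfl fun j _ => ?_
    have := congrFun (congrFun hη i) j
    rw [Matrix.transpose_apply, Matrix.neg_apply] at this
    rw [this]
    ring
  linarith

/-- A rigid motion that vanishes on a set of codimension one vanishes. -/
theorem eq_zero_of_mem_rigidMotion_of_eqOn {d : ℕ} {v : C(E d, E d)} (hv : v ∈ rigidMotion d)
    {e : Set (E d)} (hne : e.Nonempty) (he : d ≤ Module.finrank ℝ (vectorSpan ℝ e) + 1)
    (h : ∀ x ∈ e, v x = 0) : v = 0 := by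
  have hin := inner_sub_sub_eq_zero_of_mem_rigidMotion hv
  obtain ⟨a, η, -, hη⟩ := hv
  set L := Matrix.toEuclideanLin η with hL
  have hL0 : ∀ x, inner ℝ (L x) x = 0 := fun x => by simpa [hη] using hin x 0
  have hLs : ∀ x y, inner ℝ (L x) y = -inner ℝ (L y) x := by
    intro x y
    have h1 := hL0 (x + y)
    rw [map_add, inner_add_left, inner_add_right, inner_add_right, hL0, hL0] at h1
    linarith
  set W := vectorSpan ℝ e with hW
  have hLW : W ≤ LinearMap.ker L := by
    rw [hW, vectorSpan, Submodule.span_le]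
    rintro _ ⟨x, hx, y, hy, rfl⟩
    have h1 := h x hx
    have h2 := h y hy
    rw [hη] at h1 h2
    show L (x - y) = 0
    rw [map_sub, sub_eq_zero]
    exact add_left_cancel (h1.trans h2.symm)
  have hrank : Module.finrank ℝ Wᗮ ≤ 1 := by
    have := W.finrank_add_finrank_orthogonal
    rw [finrank_euclideanSpace_fin] at this
    omega
  -- By skewness `L` maps into `Wᗮ`, which is at most a line; there `L n` is both a multiple of `n`
  -- and orthogonal to `n`, hence zero.
  have hrange : ∀ x, L x ∈ Wᗮ := fun x => by
    rw [Submodule.mem_orthogonal']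
    intro w hw
    rw [hLs, hLW hw, inner_zero_left, neg_zero]
  have hperp : Wᗮ ≤ LinearMap.ker L := by
    intro n hn
    rcases eq_or_ne n 0 with rfl | hn0
    · exact zero_mem _
    obtain ⟨b, hb⟩ := finrank_le_one_iff.1 hrank
    obtain ⟨s, hs⟩ := hb ⟨n, hn⟩
    obtain ⟨t, ht⟩ := hb ⟨L n, hrange n⟩
    have hs : s • (b : E d) = n := congrArg Subtype.val hs
    have ht : t • (b : E d) = L n := congrArg Subtype.val ht
    have hs0 : s ≠ 0 := by rintro rfl; exact hn0 (by rw [← hs, zero_smul])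
    have h1 : L n = (t / s) • n := by rw [← hs, smul_smul, div_mul_cancel₀ _ hs0, hs, ht]
    have h2 := hL0 n
    rw [h1, inner_smul_left, mul_eq_zero] at h2
    rcases h2 with h2 | h2
    · show L n = 0
      rw [h1, show t / s = 0 by simpa using h2, zero_smul]
    · exact absurd (inner_self_eq_zero.1 h2) hn0
  have hLz : ∀ x, L x = 0 := fun x => by
    have : (⊤ : Submodule ℝ (E d)) ≤ LinearMap.ker L := by
      rw [← Submodule.sup_orthogonal_of_hasOrthogonalProjection (K := W)]
      exact sup_le hLW hperp
    exact this trivial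
  obtain ⟨x₀, hx₀⟩ := hne
  have ha : a = 0 := by simpa [hη, hLz] using h x₀ hx₀
  ext1 x
  rw [hη, hLz, ha, add_zero, ContinuousMap.zero_apply]

/-- A continuous field with zero trace on a face vanishes on the face. -/
theorem eq_zero_of_trace_eq_zero {d : ℕ} {e : Set (E d)} (h : IsPolytope (d - 1) e)
    {v : C(E d, E d)} (hv : trace h v = 0) {x : E d} (hx : x ∈ e) : v x = 0 := by
  by_contra hne
  have hae : ∀ᵐ y ∂faceMeasure e, v y = 0 := by
    have h1 := (h.memLp v).coeFn_toLp
    have h2 : (h.memLp v).toLp v = 0 := hv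
    rw [h2] at h1
    filter_upwards [h1, Lp.coeFn_zero (E d) 2 (faceMeasure e)] with y hy hy0
    rw [← hy, hy0, Pi.zero_apply]
  rw [ae_restrict_iff' h.isCompact.measurableSet] at hae
  have hV : IsOpen {y | v y ≠ 0} := isOpen_ne_fun v.continuous continuous_const
  obtain ⟨y, hyV, hy⟩ := mem_closure_iff.1 (h.subset_closure_intrinsicInterior hx) _ hV hne
  obtain ⟨hyS, U, hU, hyU, hUe⟩ := mem_intrinsicInterior_iff_exists_isOpen.1 hy
  have hpos := measure_open_inter_affineSubspace_pos (affineSpan ℝ e) (n := d - 1)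
    (by rw [direction_affineSpan, h.finrank_vectorSpan]) (hU.inter hV) ⟨hyU, hyV⟩ hyS
  refine hpos.ne' (measure_mono_null ?_ hae)
  rintro z ⟨⟨hzU, hzV⟩, hz⟩ hz'
  exact hzV (hz' (hUe ⟨hzU, hz⟩))

/-! ### The triple norm as a sum of squares -/

/-- The square root of a finite sum of squares of seminorms, as a seminorm. -/
def sqrtSumSq {V ι : Type*} [AddCommGroup V] [Module ℝ V] [Fintype ι] (p : ι → Seminorm ℝ V) :
    Seminorm ℝ V :=
  Seminorm.of (fun v => Real.sqrt (∑ i, p i v ^ 2))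
    (fun v w => by
      have h : ∀ a : ι → ℝ, Real.sqrt (∑ i, a i ^ 2) = ‖(WithLp.toLp 2 a : EuclideanSpace ℝ ι)‖ :=
        fun a => by simp [EuclideanSpace.norm_eq]
      calc Real.sqrt (∑ i, p i (v + w) ^ 2) ≤ Real.sqrt (∑ i, (p i v + p i w) ^ 2) := by
            gcongr with i
            exact map_add_le_add (p i) v w
        _ = ‖(WithLp.toLp 2 (fun i => p i v) : EuclideanSpace ℝ ι) +
              WithLp.toLp 2 (fun i => p i w)‖ := by rw [h]; rfl
        _ ≤ _ := by
            rw [h, h]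
            exact norm_add_le _ _)
    (fun c v => by
      simp only [map_smul_eq_mul, mul_pow, ← Finset.mul_sum]
      rw [Real.sqrt_mul (sq_nonneg _), Real.sqrt_sq (norm_nonneg _)])

theorem sqrtSumSq_apply {V ι : Type*} [AddCommGroup V] [Module ℝ V] [Fintype ι]
    (p : ι → Seminorm ℝ V) (v : V) : sqrtSumSq p v = Real.sqrt (∑ i, p i v ^ 2) := rfl

theorem sqrtSumSq_eq_zero_iff {V ι : Type*} [AddCommGroup V] [Module ℝ V] [Fintype ι]
    (p : ι → Seminorm ℝ V) (v : V) : sqrtSumSq p v = 0 ↔ ∀ i, p i v = 0 := by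
  rw [sqrtSumSq_apply, Real.sqrt_eq_zero (Finset.sum_nonneg fun i _ => sq_nonneg _),
    Finset.sum_eq_zero_iff_of_nonneg fun i _ => sq_nonneg _]
  simp

/-- The strain tensor as a Euclidean vector. -/
def strainVec {d : ℕ} (v : C(E d, E d)) (x : E d) : EuclideanSpace ℝ (Fin d × Fin d) :=
  WithLp.toLp 2 fun ij => strain v x ij.1 ij.2

theorem norm_strainVec_sq {d : ℕ} (v : C(E d, E d)) (x : E d) :
    ‖strainVec v x‖ ^ 2 = ∑ i, ∑ j, strain v x i j ^ 2 := by
  rw [EuclideanSpace.norm_sq_eq, Fintype.sum_prod_type]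
  simp [strainVec]

theorem continuous_strainVec {d r : ℕ} {v : C(E d, E d)} (hv : v ∈ polyField d r) :
    Continuous (strainVec v) :=
  (PiLp.continuous_toLp 2 _).comp (continuous_pi fun ij => (contDiff_strain hv ij.1 ij.2).continuous)

theorem memLp_strainVec {d r : ℕ} {v : C(E d, E d)} (hv : v ∈ polyField d r) {T : Set (E d)}
    (hT : IsCompact T) : MemLp (strainVec v) 2 (volume.restrict T) := by
  have : IsFiniteMeasure (volume.restrict T) := ⟨by
    rw [Measure.restrict_apply_univ]; exact hT.measure_lt_top⟩
  obtain ⟨C, hC⟩ := hT.exists_bound_of_continuousOn (continuous_strainVec hv).continuousOn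
  exact MemLp.of_bound (continuous_strainVec hv).aestronglyMeasurable C
    ((ae_restrict_iff' hT.measurableSet).2 (Filter.Eventually.of_forall hC))

/-- The strain tensor of a polynomial field as an `L²` field on `T`. -/
def strainLp {d : ℕ} (r : ℕ) {T : Set (E d)} (hT : IsCompact T) :
    polyField d r →ₗ[ℝ] Lp (EuclideanSpace ℝ (Fin d × Fin d)) 2 (volume.restrict T) where
  toFun v := (memLp_strainVec v.2 hT).toLp _
  map_add' v w := by
    rw [← MemLp.toLp_add]
    congr 1
    ext x ij
    have hd : ∀ u : polyField d r, DifferentiableAt ℝ (u : C(E d, E d)) x := fun u =>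
      (contDiff_of_mem_polyField u.2).contDiffAt.differentiableAt (by simp)
    have : fderiv ℝ ((v + w : polyField d r) : C(E d, E d)) x =
      fderiv ℝ (v : C(E d, E d)) x + fderiv ℝ (w : C(E d, E d)) x := fderiv_add (hd v) (hd w)
    simp only [strainVec, strain, this, Pi.add_apply, _root_.add_apply,
      PiLp.add_apply]
    ring
  map_smul' c v := by
    rw [RingHom.id_apply, ← MemLp.toLp_const_smul]
    congr 1
    ext x ij
    have hd : DifferentiableAt ℝ (v : C(E d, E d)) x :=
      (contDiff_of_mem_polyField v.2).contDiffAt.differentiableAt (by simp)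
    have : fderiv ℝ ((c • v : polyField d r) : C(E d, E d)) x =
      c • fderiv ℝ (v : C(E d, E d)) x := fderiv_const_smul hd c
    simp only [strainVec, strain, this, Pi.smul_apply, _root_.smul_apply,
      PiLp.smul_apply, smul_eq_mul]
    ring

theorem norm_strainLp_sq {d r : ℕ} {T : Set (E d)} (hT : IsCompact T) (v : polyField d r) :
    ‖strainLp r hT v‖ ^ 2 = ∫ x in T, ∑ i, ∑ j, strain (v : C(E d, E d)) x i j ^ 2 := by
  rw [← real_inner_self_eq_norm_sq, L2.inner_def]
  refine integral_congr_ae ?_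
  filter_upwards [(memLp_strainVec v.2 hT).coeFn_toLp] with x hx
  rw [← norm_strainVec_sq, ← hx, real_inner_self_eq_norm_sq]
  rfl

/-- By continuity the strain vanishes on the interior of `T`, and by analyticity on all of `ℝ^d`. -/
theorem mem_rigidMotion_of_strainLp_eq_zero {d r : ℕ} {T : Set (E d)} (hT : IsCompact T)
    (hTi : (interior T).Nonempty) {v : polyField d r} (h : strainLp r hT v = 0) :
    (v : C(E d, E d)) ∈ rigidMotion d := by
  have hae : strainVec (v : C(E d, E d)) =ᵐ[volume.restrict (interior T)] fun _ => 0 := by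
    refine ae_mono (Measure.restrict_mono interior_subset le_rfl) ?_
    have h1 := (memLp_strainVec v.2 hT).coeFn_toLp
    have h2 : (memLp_strainVec v.2 hT).toLp _ = 0 := h
    rw [h2] at h1
    filter_upwards [h1, Lp.coeFn_zero (EuclideanSpace ℝ (Fin d × Fin d)) 2 (volume.restrict T)]
      with y hy hy0
    rw [← hy, hy0, Pi.zero_apply]
  have heq := Measure.eqOn_open_of_ae_eq hae isOpen_interior
    (continuous_strainVec v.2).continuousOn continuousOn_const
  refine mem_rigidMotion_of_inner_sub_sub_eq_zero (inner_sub_sub_eq_zero_of_strain_eq_zero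
    ((contDiff_of_mem_polyField v.2).differentiable (by simp)) fun x i j =>
      strain_eq_zero_of_eqOn_isOpen v.2 isOpen_interior hTi (fun y hy => ?_) x)
  exact congrFun (congrArg WithLp.ofLp (heq hy)) (i, j)

/-- The reason for including the rigid motions in `V_{k-1}(e)`; for `k = 1` the constants alone
would not suffice. -/
theorem Qb_trace_eq_of_mem_rigidMotion {d : ℕ} (k : ℕ) {e : Set (E d)}
    (h : IsPolytope (d - 1) e) {v : C(E d, E d)} (hv : v ∈ rigidMotion d) :
    Qb k h (trace h v) = trace h v :=
  Submodule.starProjection_eq_self_iff.2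
    (Submodule.mem_sup_right (Submodule.mem_map_of_mem hv))

namespace Partition

variable {d : ℕ} {Ω : Set (E d)} (𝒯 : Partition Ω)

/-- The jump `Q_b v_0 - v_b` on a face `e`, with `v_0` taken from the element `T`. -/
def jump (k : ℕ) (T : 𝒯.cells) (e : 𝒯.faces) :
    𝒯.WeakFunction →ₗ[ℝ] FaceL2 (e : Set (E d)) where
  toFun v := Qb k (𝒯.isPolytope_face e e.2) (trace (𝒯.isPolytope_face e e.2) (v.1 T)) - v.2 e
  map_add' v w := by
    rw [Prod.fst_add, Prod.snd_add, Pi.add_apply, Pi.add_apply, map_add, map_add]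
    abel
  map_smul' c v := by
    rw [Prod.smul_fst, Prod.smul_snd, Pi.smul_apply, Pi.smul_apply, map_smul, map_smul,
      RingHom.id_apply, smul_sub]

/-- The field of a weak finite element function on the element `T`. -/
def fieldOnCell (k : ℕ) (T : 𝒯.cells) : 𝒯.Vh k →ₗ[ℝ] polyField d k where
  toFun v := ⟨v.1.1 T, v.2.1 T⟩
  map_add' _ _ := rfl
  map_smul' _ _ := rfl

open scoped Classical in
/-- The seminorms whose squares add up to the square of the triple norm. -/
def tripleNormPart (k : ℕ) : 𝒯.cells × Option 𝒯.faces → Seminorm ℝ (𝒯.Vh k)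
  | (T, none) => (normSeminorm ℝ _).comp
      (strainLp k (𝒯.isPolytope_cell T T.2).isCompact ∘ₗ 𝒯.fieldOnCell k T)
  -- The weight enters through its square root because the parts are squared.
  | (T, some e) => if (e : Set (E d)) ⊆ frontier (T : Set (E d)) then
      (normSeminorm ℝ _).comp
        (Real.sqrt (Metric.diam (T : Set (E d)))⁻¹ • (𝒯.jump k T e ∘ₗ (𝒯.Vh k).subtype)) else 0

theorem tripleNorm_eq_sqrtSumSq (k : ℕ) (v : 𝒯.Vh k) :
    𝒯.tripleNorm k v = sqrtSumSq (𝒯.tripleNormPart k) v := by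
  classical
  rw [sqrtSumSq_apply, tripleNorm, Fintype.sum_prod_type]
  congr 1
  refine Finset.sum_congr rfl fun T _ => ?_
  rw [Fintype.sum_option, Finset.mul_sum]
  congr 1
  · exact (norm_strainLp_sq (𝒯.isPolytope_cell T T.2).isCompact (𝒯.fieldOnCell k T v)).symm
  · refine Finset.sum_congr rfl fun e _ => ?_
    simp only [tripleNormPart]
    split_ifs with h
    · rw [Seminorm.comp_apply, coe_normSeminorm, LinearMap.smul_apply, norm_smul, mul_pow,
        Real.norm_of_nonneg (Real.sqrt_nonneg _), Real.sq_sqrt (inv_nonneg.2 Metric.diam_nonneg)]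
      rfl
    · simp

/-! ### Definiteness -/

variable {𝒯}

/-- Excludes the default value `0⁻¹ = 0`, which would erase the jump terms. -/
theorem diam_cell_pos (hd : 1 ≤ d) {T : Set (E d)} (hT : T ∈ 𝒯.cells) : 0 < Metric.diam T := by
  obtain ⟨y, hy⟩ := (𝒯.isPolytope_cell T hT).nonempty_interior
  have hn : (EuclideanSpace.single ⟨0, hd⟩ 1 : E d) ≠ 0 := by simp
  obtain ⟨t, ht, hyt⟩ := exists_pos_add_smul_mem isOpen_interior hy
    (EuclideanSpace.single ⟨0, hd⟩ 1)
  refine Metric.diam_pos ⟨y, interior_subset hy, _, interior_subset hyt, fun h => ?_⟩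
    (𝒯.isPolytope_cell T hT).isCompact.isBounded
  exact smul_ne_zero ht.ne' hn (left_eq_add.1 h)

theorem rigid_and_trace_of_tripleNorm_eq_zero (hd : 1 ≤ d) {k : ℕ} {v : 𝒯.WeakFunction}
    (hv : v ∈ 𝒯.Vh k) (h : 𝒯.tripleNorm k v = 0) (T : 𝒯.cells) :
    v.1 T ∈ rigidMotion d ∧ ∀ e : 𝒯.faces, (e : Set (E d)) ⊆ frontier (T : Set (E d)) →
      v.2 e = trace (𝒯.isPolytope_face e e.2) (v.1 T) := by
  have h0 := (sqrtSumSq_eq_zero_iff _ _).1 ((𝒯.tripleNorm_eq_sqrtSumSq k ⟨v, hv⟩).symm.trans h)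
  have hr : v.1 T ∈ rigidMotion d := mem_rigidMotion_of_strainLp_eq_zero
    (v := 𝒯.fieldOnCell k T ⟨v, hv⟩) (𝒯.isPolytope_cell T T.2).isCompact
    (𝒯.isPolytope_cell T T.2).nonempty_interior
    (norm_eq_zero.1 (h0 (T, none)))
  refine ⟨hr, fun e he => ?_⟩
  have h1 := h0 (T, some e)
  simp only [tripleNormPart, if_pos he] at h1
  rw [Seminorm.comp_apply, coe_normSeminorm, norm_eq_zero, LinearMap.smul_apply,
    smul_eq_zero] at h1
  have h2 : Qb k (𝒯.isPolytope_face e e.2) (trace (𝒯.isPolytope_face e e.2) (v.1 T)) - v.2 e = 0 :=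
    h1.resolve_left (Real.sqrt_pos.2 (inv_pos.2 (diam_cell_pos hd T.2))).ne'
  rw [Qb_trace_eq_of_mem_rigidMotion k _ hr, sub_eq_zero] at h2
  exact h2.symm

theorem eq_zero_of_trace_eq_zero_of_mem_rigidMotion (e : 𝒯.faces) {v : C(E d, E d)}
    (hv : v ∈ rigidMotion d) (h : trace (𝒯.isPolytope_face e e.2) v = 0) : v = 0 := by
  have he := 𝒯.isPolytope_face e e.2
  refine eq_zero_of_mem_rigidMotion_of_eqOn hv
    (he.isConnected_interior.nonempty.mono (intrinsicInterior_subset (𝕜 := ℝ))) ?_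
    fun x hx => eq_zero_of_trace_eq_zero he h hx
  rw [he.finrank_vectorSpan]
  omega

theorem eq_zero_of_tripleNorm_eq_zero (hd : 1 ≤ d) (hΩo : IsOpen Ω)
    (hΩb : Bornology.IsBounded Ω) (hΩc : IsConnected Ω) {k : ℕ} {v : 𝒯.WeakFunction}
    (hv : v ∈ 𝒯.Vh0 k) (h : 𝒯.tripleNorm k v = 0) : v = 0 := by
  have key := rigid_and_trace_of_tripleNorm_eq_zero hd hv.1 h
  obtain ⟨T₀, hT₀, e₀, he₀, heT₀, heΩ⟩ := exists_face_subset_frontier hd hΩo hΩb hΩc 𝒯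
  have h0 : v.1 ⟨T₀, hT₀⟩ = 0 := eq_zero_of_trace_eq_zero_of_mem_rigidMotion ⟨e₀, he₀⟩
    (key ⟨T₀, hT₀⟩).1 (((key ⟨T₀, hT₀⟩).2 ⟨e₀, he₀⟩ heT₀).symm.trans (hv.2 ⟨e₀, he₀⟩ heΩ))
  -- Across a shared face `v_b` is single-valued: zero from one side, it forces the rigid motion on
  -- the other side to vanish on the face.
  have hall := forall_cell_of_forall_shared_face (𝒯 := 𝒯) hd hΩo hΩc
    (fun T => ∀ hT : T ∈ 𝒯.cells, v.1 ⟨T, hT⟩ = 0) (fun T hT T' hT' e he heT heT' hz _ => by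
      have h1 := (key ⟨T, hT⟩).2 ⟨e, he⟩ heT
      have h2 := (key ⟨T', hT'⟩).2 ⟨e, he⟩ heT'
      rw [hz hT, map_zero] at h1
      exact eq_zero_of_trace_eq_zero_of_mem_rigidMotion ⟨e, he⟩ (key ⟨T', hT'⟩).1
        (h2.symm.trans h1)) hT₀ fun _ => h0
  refine Prod.ext (funext fun T => hall T T.2 T.2) (funext fun e => ?_)
  obtain ⟨T, hT, heT⟩ := 𝒯.exists_cell e e.2
  rw [(key ⟨T, hT⟩).2 e heT, hall T hT hT, map_zero]
  rfl

end Partition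

end WG
end

theorem mainTheorem8 (d : ℕ) (hd : d = 2 ∨ d = 3) (Ω : Set (WG.E d)) (hΩo : IsOpen Ω)
    (hΩb : Bornology.IsBounded Ω) (hΩc : IsConnected Ω) (𝒯 : WG.Partition Ω)
    (k : ℕ) (hk : 1 ≤ k) :
    (∀ v ∈ 𝒯.Vh k, 0 ≤ 𝒯.tripleNorm k v) ∧
    (∀ v ∈ 𝒯.Vh k, ∀ c : ℝ, 𝒯.tripleNorm k (c • v) = |c| * 𝒯.tripleNorm k v) ∧
    (∀ v ∈ 𝒯.Vh k, ∀ w ∈ 𝒯.Vh k,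
      𝒯.tripleNorm k (v + w) ≤ 𝒯.tripleNorm k v + 𝒯.tripleNorm k w) ∧
    (∀ v ∈ 𝒯.Vh0 k, 𝒯.tripleNorm k v = 0 ↔ v = 0) := by
  have hN := 𝒯.tripleNorm_eq_sqrtSumSq k
  refine ⟨fun v _ => Real.sqrt_nonneg _, fun v hv c => ?_, fun v hv w hw => ?_,
    fun v hv => ⟨WG.Partition.eq_zero_of_tripleNorm_eq_zero (by omega) hΩo hΩb hΩc hv, ?_⟩⟩
  · have := map_smul_eq_mul (WG.sqrtSumSq (𝒯.tripleNormPart k)) c ⟨v, hv⟩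
    rwa [← hN, ← hN, Real.norm_eq_abs] at this
  · have := map_add_le_add (WG.sqrtSumSq (𝒯.tripleNormPart k)) ⟨v, hv⟩ ⟨w, hw⟩
    rwa [← hN, ← hN, ← hN] at this
  · rintro rfl
    have := map_zero (WG.sqrtSumSq (𝒯.tripleNormPart k))
    rwa [← hN] at this
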